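/- A labeled poset $(P,\omega)$ is a finite nonempty poset $P$, $|P|=p$, with an injection $\omega:P\to\mathbb{Z}$. A covering relation $x\lessdot y$ has sign $\epsilon(x,y)=1$ if $\omega(x)<\omega(y)$ and $\epsilon(x,y)=-1$ if $\omega(x)>\omega(y)$. $(P,\omega)$ is sign-graded of rank $r\in\mathbb{Z}$ if $\sum_{i=2}^{k}\epsilon(x_{i-1},x_i)=r$ for every maximal chain $x_1<\cdots<x_k$ of $P$. Its rank function is $\rho(x)=\sum_{i=2}^k\epsilon(x_{i-1},x_i)$ for any saturated chain $x_1<\cdots<x_k=x$ starting at a minimal element. The labeling $\omega$ of a sign-graded $(P,\omega)$ is canonical if $\rho$ takes values in $\{0,1\}$, $\omega(x)<0$ whenever $\rho(x)=0$, and $\omega(x)>0$ whenever $\rho(x)=1$. Let $\mathcal{L}(P,\omega)$ be the set of permutations $\pi=a_1\cdots a_p$ of $\omega(P)$ in which $\omega(x)$ precedes $\omega(y)$ whenever $x<_P y$. Let $\mathrm{des}(\pi)=|\{1\le i<p: a_i>a_{i+1}\}|$ and $W(P,\omega;t)=\sum_{\pi\in\mathcal{L}(P,\omega)}t^{\mathrm{des}(\pi)}$.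 Put $a_0=a_{p+1}=0$ and let $\mathrm{peak}(\pi)=|\{1\le i\le p: a_{i-1}<a_i>a_{i+1}\}|$. A letter $a_i$ ($1\le i\le p$) is a double descent if $a_{i-1}>a_i>a_{i+1}$ and a double ascent if $a_{i-1}<a_i<a_{i+1}$. For a canonical labeling, $x\in\omega(P)$ and $\pi\in\mathcal{L}(P,\omega)$, the word $\psi_x(\pi)$ is $\pi$ if $x$ is neither a double ascent nor a double descent; otherwise it is obtained by removing $x$ and inserting it between the first pair of consecutive letters $a_i,a_{i+1}$ (of $a_0a_1\cdots a_{p+1}$) encountered moving away from $x$ - to the right with $a_i<x<a_{i+1}$, if $x<0$ is a double descent; - to the left with $a_i>x>a_{i+1}$, if $x<0$ is a double ascent; - to the left with $a_i<x<a_{i+1}$, if $x>0$ is a double descent; - to the right with $a_i>x>a_{i+1}$, if $x>0$ is a double ascent. For $S\subseteq P$ let $\psi_S=\prod_{x\in S}\psi_{\omega(x)}$, and let $\mathrm{Orb}(\pi)=\{\psi_S(\pi):S\subseteq P\}$. **Theorem.** Let $(P,\omega)$ be sign-graded of rank $r$ with $P$ nonempty. 1. $d=p-r-1$ is nonnegative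 and there are nonnegative integers $a_i$ such that $$W(P,\omega;t)=\sum_{i=0}^{\lfloor d/2\rfloor}a_i\,t^i(1+t)^{d-2i}.$$ 2. Suppose moreover that $\omega$ is canonical. Then the maps $\psi_x$, $x\in\omega(P)$, are commuting involutions of $\mathcal{L}(P,\omega)$, so that $S\mapsto\psi_S$ is an action of $\mathbb{Z}_2^P$. For each $\pi\in\mathcal{L}(P,\omega)$ the orbit $\mathrm{Orb}(\pi)$ contains exactly one element $\hat\pi$ without double descents, $2\,\mathrm{des}(\hat\pi)\le p-r-1$, and $$\sum_{\sigma\in\mathrm{Orb}(\pi)}t^{\mathrm{des}(\sigma)}=t^{\mathrm{des}(\hat\pi)}(1+t)^{p-r-1-2\,\mathrm{des}(\hat\pi)}.$$ If $r=0$, then $\mathrm{peak}$ is invariant under the action and $\mathrm{peak}(\pi)=\mathrm{des}(\hat\pi)$ for all $\pi\in\mathcal{L}(P,\omega)$. Finally, the expansion in (1) holds with $a_i$ equal to the number of $\pi\in\mathcal{L}(P,\omega)$ without double descents and with $\mathrm{des}(\pi)=i$. -/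

import Mathlib

open Polynomial

namespace SignGraded

section Labeled

variable {P : Type*} [PartialOrder P]

/-- The sum of the signs of the Hasse edges `(x₁, x₂), (x₂, x₃), …` along a list `x₁, …, x_k`
of elements: an edge `(x, y)` has sign `1` if `ω x < ω y` and sign `-1` otherwise. -/
def signSum (ω : P → ℤ) : List P → ℤ
  | x :: y :: l => (if ω x < ω y then 1 else -1) + signSum ω (y :: l)
  | _ => 0

/-- `c` is a saturated chain `x₁ ⋖ x₂ ⋖ ⋯ ⋖ x_k = x` from a minimal element `x₁` to `x`.
If moreover `x` is maximal then `c` is a maximal chain of the (finite) poset, and all maximal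
chains are of this form. -/
def IsSaturatedChainTo (c : List P) (x : P) : Prop :=
  c.IsChain (· ⋖ ·) ∧ (∀ y ∈ c.head?, IsMin y) ∧ c.getLast? = some x

/-- `(P, ω)` is sign-graded of rank `r`: the sum of signs is `r` along every maximal chain. -/
def IsSignGraded (ω : P → ℤ) (r : ℤ) : Prop :=
  ∀ (c : List P) (x : P), IsSaturatedChainTo c x → IsMax x → signSum ω c = r

/-- `k` is the value at `x` of the rank function: the sum of signs along a saturated chain from a
minimal element to `x`. If `(P, ω)` is sign-graded there is exactly one such `k`. -/
def HasRank (ω : P → ℤ) (x : P) (k : ℤ) : Prop :=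
  ∃ c : List P, IsSaturatedChainTo c x ∧ signSum ω c = k

/-- The labeling is canonical: the rank function takes values in `{0, 1}`, elements of rank `0`
have negative labels and elements of rank `1` have positive labels. -/
def IsCanonical (ω : P → ℤ) : Prop :=
  ∀ (x : P) (k : ℤ), HasRank ω x k →
    (k = 0 ∨ k = 1) ∧ (k = 0 → ω x < 0) ∧ (k = 1 → 0 < ω x)

open Classical in
/-- The Jordan–Hölder set: the permutations (as words) of the set of labels in which `ω x`
precedes `ω y` whenever `x < y`. -/
noncomputable def jordanHolder [Fintype P] (ω : P → ℤ) : Finset (List ℤ) :=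
  {π ∈ (Finset.univ.image ω).val.lists.toFinset | ∀ x y : P, x < y → π.idxOf (ω x) < π.idxOf (ω y)}

end Labeled

/-- The number of descents `a_i > a_{i+1}`, `1 ≤ i < p`, of a word `a₁ ⋯ a_p`. -/
def des : List ℤ → ℕ
  | a :: b :: l => (if b < a then 1 else 0) + des (b :: l)
  | _ => 0

/-- The number of consecutive triples `a, b, c` of a word with `a < b > c`. -/
def innerPeaks : List ℤ → ℕ
  | a :: b :: c :: l => (if a < b ∧ c < b then 1 else 0) + innerPeaks (b :: c :: l)
  | _ => 0

/-- The number of indices `1 ≤ i ≤ p` with `a_{i-1} < a_i > a_{i+1}`, where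
`a₀ = a_{p+1} = 0`. -/
def peak (π : List ℤ) : ℕ := innerPeaks (0 :: π ++ [0])

/-- The part of the word `π` to the left of the letter `x`. -/
def before (π : List ℤ) (x : ℤ) : List ℤ := π.takeWhile (fun a => a ≠ x)

/-- The part of the word `π` to the right of the letter `x`. -/
def after (π : List ℤ) (x : ℤ) : List ℤ := (π.dropWhile (fun a => a ≠ x)).tail

/-- The left neighbour of the letter `x` in the word `0 π 0`. -/
def prev (π : List ℤ) (x : ℤ) : ℤ := (before π x).getLastD 0

/-- The right neighbour of the letter `x` in the word `0 π 0`. -/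
def next (π : List ℤ) (x : ℤ) : ℤ := (after π x).headD 0

/-- `x` is a double descent of `0 π 0`. -/
def IsDoubleDescent (π : List ℤ) (x : ℤ) : Prop := x < prev π x ∧ next π x < x

/-- `x` is a double ascent of `0 π 0`. -/
def IsDoubleAscent (π : List ℤ) (x : ℤ) : Prop := prev π x < x ∧ x < next π x

instance (π : List ℤ) (x : ℤ) : Decidable (IsDoubleDescent π x) :=
  inferInstanceAs (Decidable (_ ∧ _))

instance (π : List ℤ) (x : ℤ) : Decidable (IsDoubleAscent π x) :=
  inferInstanceAs (Decidable (_ ∧ _))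

/-- Insert `x` between the first (leftmost) two consecutive letters `a, b` of the word `R 0` for
which `Q a b` holds. (If there are none, `x` is put at the end; this never occurs below.) -/
def insertFirst (Q : ℤ → ℤ → Bool) (x : ℤ) : List ℤ → List ℤ
  | [] => [x]
  | a :: R => if Q a (R.headD 0) then a :: x :: R else a :: insertFirst Q x R

/-- Insert `x` between the last (rightmost) two consecutive letters `a, b` of the word `0 L` for
which `Q a b` holds. -/
def insertLast (Q : ℤ → ℤ → Bool) (x : ℤ) (L : List ℤ) : List ℤ :=
  (insertFirst (fun b a => Q a b) x L.reverse).reverse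

/-- The map `ψ_x`. -/
def psi (x : ℤ) (π : List ℤ) : List ℤ :=
  if x ∈ π then
    if IsDoubleDescent π x then
      if x < 0 then before π x ++ insertFirst (fun a b => a < x ∧ x < b) x (after π x)
      else insertLast (fun a b => a < x ∧ x < b) x (before π x) ++ after π x
    else if IsDoubleAscent π x then
      if x < 0 then insertLast (fun a b => b < x ∧ x < a) x (before π x) ++ after π x
      else before π x ++ insertFirst (fun a b => b < x ∧ x < a) x (after π x)
    else π
  else π

section Action

variable {P : Type*} [PartialOrder P] [Fintype P]

/-- `ψ_S`, the composite of the maps `ψ_{ω x}`, `x ∈ S`. They commute on the Jordan–Hölder set of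
a canonically labeled sign-graded poset, so that the order of composition is immaterial there; it
is fixed here by size of the labels. -/
def psiSet (ω : P → ℤ) (S : Finset P) (π : List ℤ) : List ℤ :=
  ((S.image ω).sort (· ≤ ·)).foldr psi π

/-- The orbit of `π`, that is, the set of all `ψ_S π` with `S ⊆ P`. -/
noncomputable def orb (ω : P → ℤ) (π : List ℤ) : Finset (List ℤ) :=
  (Finset.univ : Finset (Finset P)).image (fun S => psiSet ω S π)

/-- The `(P, ω)`-Eulerian polynomial. -/
noncomputable def eulerianPoly (ω : P → ℤ) : ℤ[X] := ∑ π ∈ jordanHolder ω, X ^ des π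

end Action

/-- `0 π 0` has no double descents. -/
def NoDoubleDescent (π : List ℤ) : Prop := ∀ x ∈ π, ¬ IsDoubleDescent π x

instance (π : List ℤ) : Decidable (NoDoubleDescent π) :=
  inferInstanceAs (Decidable (∀ x ∈ π, ¬ IsDoubleDescent π x))

end SignGraded

/-! Write a word as `A L x R B`, with `L` and `R` the longest runs next to `x` of letters of the
same sign as `x` and larger absolute value. The letter `x` is a double ascent or double descent
exactly when one of `L`, `R` is empty and the other is not, and then ψ_x moves `x` past the nonempty
run (`psi_word`). So ψ_x exchanges the two sides of `x` within the block `L x R`: it is an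
involution and respects reversal. The maps commute because blocks of different letters are disjoint
or nested, one lying in a run of the other (`psi_comm`).

Under a canonical labeling the signs of labels alternate along covers. If `x < v` and the label of
`v` lay in a run next to `x`, a cover of `x` below `v` would have the opposite sign, hence lie
outside the run, yet it must occur between the two. So moving `x` past the run yields another linear
extension (`IsAlternating.psi_mem`).

A move keeps the comparisons of every other letter with its two neighbours, and turns `x` from a
double descent into a double ascent or back. Hence the set F of double ascents and double descents
is constant on an orbit, while any subset of F occurs exactly once as the set D of double descents
(`IsAlternating.psiSet_sets`). Counting the descents of `0 π 0` by left and by right ends gives |F|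
+ 2(des - |D|) = p - r - 1 (`IsAlternating.des_counts`). So des = des(hat) + |D| on an orbit, and
the subsets of F contribute t^des(hat) (1+t)^|F|.

For an arbitrary sign-graded labeling, W depends only on the signs of covers (`eulerianPoly_congr`),
and the ranks can be pushed into {0, 1}. Lowering all elements of top rank m ≥ 2 by two reverses the
signs of just the covers that meet them; this is realized by moving their labels from above all
others to below all others. The number of descents then changes only if the last letter belongs to
the moved block, that is, if r = m. In that case W is multiplied by t and p - r - 1 grows by 2,
which only shifts the coefficients of the expansion. Elements of lowest negative rank are treated
dually. -/

namespace SignGraded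

/-! ### Words: ψ_x as an exchange of runs. -/

/-- The letter `a` lies on the far side of `x`, as seen from `0`. -/
def Inside (x a : ℤ) : Prop := (x < 0 ∧ a < x) ∨ (0 < x ∧ x < a)

theorem Inside.ne {x a : ℤ} (h : Inside x a) : a ≠ x := by
  unfold Inside at h; omega

/-- The boundary letters 0 are never inside `x`, so a run of inside letters stops at the ends of the
word. -/
theorem not_inside_zero (x : ℤ) : ¬ Inside x 0 := by
  unfold Inside; omega

theorem Inside.trans {x y a : ℤ} (h : Inside y x) (h' : Inside x a) : Inside y a := by
  unfold Inside at *; omega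

theorem getLastD_mem {α : Type*} {l : List α} (h : l ≠ []) (d : α) : l.getLastD d ∈ l := by
  rw [List.getLastD_eq_getLast?, List.getLast?_eq_some_getLast h]
  exact List.getLast_mem h

theorem headD_mem {α : Type*} {l : List α} (h : l ≠ []) (d : α) : l.headD d ∈ l := by
  cases l with
  | nil => exact absurd rfl h
  | cons a l => simp

theorem getLastD_append {α : Type*} (A : List α) {L : List α} (h : L ≠ []) (d : α) :
    (A ++ L).getLastD d = L.getLastD d := by
  rw [List.getLastD_eq_getLast?, List.getLastD_eq_getLast?, List.getLast?_append,
    List.getLast?_eq_some_getLast h]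
  simp

theorem headD_append {α : Type*} {R : List α} (B : List α) (h : R ≠ []) (d : α) :
    (R ++ B).headD d = R.headD d := by
  cases R with
  | nil => exact absurd rfl h
  | cons a l => simp

theorem headD_reverse {α : Type*} (A : List α) (d : α) :
    A.reverse.headD d = A.getLastD d := by
  rw [List.headD_eq_head?_getD, List.head?_reverse, List.getLastD_eq_getLast?]

theorem before_append_cons {x : ℤ} {U : List ℤ} (V : List ℤ) (h : x ∉ U) :
    before (U ++ x :: V) x = U := by
  unfold before
  rw [List.takeWhile_append_of_pos]
  · simp
  · intro a ha
    simpa using fun e : a = x => h (e ▸ ha)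

theorem after_append_cons {x : ℤ} {U : List ℤ} (V : List ℤ) (h : x ∉ U) :
    after (U ++ x :: V) x = V := by
  unfold after
  rw [List.dropWhile_append_of_pos]
  · simp
  · intro a ha
    simpa using fun e : a = x => h (e ▸ ha)

theorem prev_append_cons {x : ℤ} {U : List ℤ} (V : List ℤ) (h : x ∉ U) :
    prev (U ++ x :: V) x = U.getLastD 0 := by
  rw [prev, before_append_cons V h]

theorem next_append_cons {x : ℤ} {U : List ℤ} (V : List ℤ) (h : x ∉ U) :
    next (U ++ x :: V) x = V.headD 0 := by
  rw [next, after_append_cons V h]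

/-- No gap within the run `R` qualifies and the gap at its end does, so the search stops there;
`B.headD 0` supplies the closing 0 when `B` is empty. -/
theorem insertFirst_append (Q : ℤ → ℤ → Bool) (x : ℤ) {R : List ℤ} (B : List ℤ) (hR : R ≠ [])
    (h₁ : ∀ a ∈ R, ∀ b ∈ R, Q a b = false) (h₂ : ∀ a ∈ R, Q a (B.headD 0) = true) :
    insertFirst Q x (R ++ B) = R ++ x :: B := by
  induction R with
  | nil => exact absurd rfl hR
  | cons a R ih =>
    rcases R with _ | ⟨b, R⟩
    · have := h₂ a (by simp)
      simp only [List.cons_append, List.nil_append, insertFirst, this, if_true]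
    · have hab := h₁ a (by simp) b (by simp)
      have := ih (by simp) (fun a ha b hb => h₁ a (by simp [ha]) b (by simp [hb]))
        (fun a ha => h₂ a (by simp [ha]))
      rw [List.cons_append, insertFirst, this]
      simp [hab]

theorem insertLast_append (Q : ℤ → ℤ → Bool) (x : ℤ) (A : List ℤ) {L : List ℤ} (hL : L ≠ [])
    (h₁ : ∀ a ∈ L, ∀ b ∈ L, Q a b = false) (h₂ : ∀ b ∈ L, Q (A.getLastD 0) b = true) :
    insertLast Q x (A ++ L) = A ++ x :: L := by
  unfold insertLast
  rw [List.reverse_append, insertFirst_append]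
  · simp
  · simpa using hL
  · intro a ha b hb
    exact h₁ b (by simpa using hb) a (by simpa using ha)
  · intro a ha
    rw [headD_reverse]
    exact h₂ a (by simpa using ha)

/-- Exchange the two sides of `x` in `L x R` if one of them is empty. -/
def flip (L : List ℤ) (x : ℤ) (R : List ℤ) : List ℤ :=
  if L = [] ∨ R = [] then R ++ x :: L else L ++ x :: R

/-- `A L x R B` is the factorization of a word with `L` and `R` the maximal runs of letters inside
`x` next to `x`. -/
structure Factors (x : ℤ) (A L R B : List ℤ) : Prop where
  left : ∀ a ∈ L, Inside x a
  right : ∀ a ∈ R, Inside x a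
  last : ¬ Inside x (A.getLastD 0)
  head : ¬ Inside x (B.headD 0)

/-- The word with factors `A`, `L`, `x`, `R`, `B`. -/
def word (A L : List ℤ) (x : ℤ) (R B : List ℤ) : List ℤ := A ++ (L ++ x :: R) ++ B

/-- The factorization after flipping. -/
theorem psi_word {x : ℤ} (hx : x ≠ 0) {A L R B : List ℤ} (h : Factors x A L R B)
    (hA : x ∉ A) (hB : x ∉ B) : psi x (word A L x R B) = A ++ flip L x R ++ B := by
  have hL : x ∉ L := fun m => (h.left x m).ne rfl
  have hAL : x ∉ A ++ L := by simp [hA, hL]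
  have e : word A L x R B = (A ++ L) ++ x :: (R ++ B) := by simp [word]
  have hp := prev_append_cons (R ++ B) hAL
  have hn := next_append_cons (R ++ B) hAL
  have hb := before_append_cons (R ++ B) hAL
  have ha := after_append_cons (R ++ B) hAL
  have hlA : A.getLastD 0 ≠ x := by
    rcases eq_or_ne A [] with rfl | hne
    · simpa using hx.symm
    · intro e; exact hA (e ▸ getLastD_mem hne 0)
  have hhB : B.headD 0 ≠ x := by
    rcases eq_or_ne B [] with rfl | hne
    · simpa using hx.symm
    · intro e; exact hB (e ▸ headD_mem hne 0)
  have h1 := h.last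
  have h2 := h.head
  rw [e]
  have hmem : x ∈ (A ++ L) ++ x :: (R ++ B) := by simp
  unfold psi
  rw [if_pos hmem]
  have hD : IsDoubleDescent ((A ++ L) ++ x :: (R ++ B)) x ↔
      x < (A ++ L).getLastD 0 ∧ (R ++ B).headD 0 < x := by rw [IsDoubleDescent, hp, hn]
  have hU : IsDoubleAscent ((A ++ L) ++ x :: (R ++ B)) x ↔
      (A ++ L).getLastD 0 < x ∧ x < (R ++ B).headD 0 := by rw [IsDoubleAscent, hp, hn]
  simp only [hD, hU, hb, ha]
  clear hD hU hp hn hb ha hmem e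
  -- With both runs empty or both nonempty, `x` is a peak or a valley and stays. With one empty, the
  -- sign of `x` decides between double descent and double ascent, and the search goes through the
  -- nonempty run.
  rcases eq_or_ne L [] with rfl | hLne <;> rcases eq_or_ne R [] with rfl | hRne
  · simp only [List.append_nil, List.nil_append]
    unfold Inside at h1 h2
    rw [if_neg (by omega), if_neg (by omega)]
    simp [flip]
  · rw [List.append_nil, headD_append B hRne]
    have h3 := h.right _ (headD_mem hRne 0)
    unfold Inside at h1 h2 h3
    rcases lt_or_gt_of_ne hx with hx | hx
    · rw [if_pos (by omega), if_pos hx, insertFirst_append _ _ _ hRne]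
      · simp [flip]
      · intro a ha b hb
        have h4 := h.right a ha
        have h5 := h.right b hb
        unfold Inside at h4 h5
        simp; omega
      · intro a ha
        have h4 := h.right a ha
        unfold Inside at h4
        simp only [decide_eq_true_eq]; omega
    · rw [if_neg (by omega), if_pos (by omega), if_neg (by omega), insertFirst_append _ _ _ hRne]
      · simp [flip]
      · intro a ha b hb
        have h4 := h.right a ha
        have h5 := h.right b hb
        unfold Inside at h4 h5
        simp; omega
      · intro a ha
        have h4 := h.right a ha
        unfold Inside at h4
        simp only [decide_eq_true_eq]; omega
  · rw [List.nil_append, getLastD_append A hLne]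
    have h3 := h.left _ (getLastD_mem hLne 0)
    unfold Inside at h1 h2 h3
    rcases lt_or_gt_of_ne hx with hx | hx
    · rw [if_neg (by omega), if_pos (by omega), if_pos hx, insertLast_append _ _ _ hLne]
      · simp [flip]
      · intro a ha b hb
        have h4 := h.left a ha
        have h5 := h.left b hb
        unfold Inside at h4 h5
        simp; omega
      · intro a ha
        have h4 := h.left a ha
        unfold Inside at h4
        simp only [decide_eq_true_eq]; omega
    · rw [if_pos (by omega), if_neg (by omega), insertLast_append _ _ _ hLne]
      · simp [flip]
      · intro a ha b hb
        have h4 := h.left a ha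
        have h5 := h.left b hb
        unfold Inside at h4 h5
        simp; omega
      · intro a ha
        have h4 := h.left a ha
        unfold Inside at h4
        simp only [decide_eq_true_eq]; omega
  · rw [getLastD_append A hLne, headD_append B hRne]
    have h3 := h.left _ (getLastD_mem hLne 0)
    have h4 := h.right _ (headD_mem hRne 0)
    unfold Inside at h3 h4
    rw [if_neg (by omega), if_neg (by omega)]
    simp [flip, hLne, hRne]

theorem exists_prefix_factor (p : ℤ → Prop) (h0 : ¬ p 0) (l : List ℤ) :
    ∃ R B, l = R ++ B ∧ (∀ a ∈ R, p a) ∧ ¬ p (B.headD 0) := by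
  induction l with
  | nil => exact ⟨[], [], rfl, by simp, by simpa using h0⟩
  | cons a l ih =>
    by_cases ha : p a
    · obtain ⟨R, B, e, h1, h2⟩ := ih
      exact ⟨a :: R, B, by simp [e], by simpa [ha] using h1, h2⟩
    · exact ⟨[], a :: l, rfl, by simp, by simpa using ha⟩

theorem exists_factors {x : ℤ} {π : List ℤ} (h : x ∈ π) :
    ∃ A L R B, π = word A L x R B ∧ Factors x A L R B := by
  obtain ⟨U, V, rfl⟩ := List.append_of_mem h
  obtain ⟨R, B, rfl, hR, hB⟩ := exists_prefix_factor (Inside x) (not_inside_zero x) V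
  obtain ⟨L, A, e, hL, hA⟩ := exists_prefix_factor (Inside x) (not_inside_zero x) U.reverse
  refine ⟨A.reverse, L.reverse, R, B, ?_, ?_, hR, ?_, hB⟩
  · have : U = A.reverse ++ L.reverse := by
      rw [← List.reverse_append, ← e, List.reverse_reverse]
    simp [word, this]
  · simpa using hL
  · rwa [← headD_reverse, List.reverse_reverse]

theorem flip_flip {L : List ℤ} {x : ℤ} {R : List ℤ} :
    (flip L x R = R ++ x :: L ∧ flip R x L = L ++ x :: R) ∨
    (flip L x R = L ++ x :: R) := by
  unfold flip
  split_ifs <;> grind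

theorem flip_perm (L : List ℤ) (x : ℤ) (R : List ℤ) : (flip L x R).Perm (L ++ x :: R) := by
  unfold flip
  split_ifs
  · exact List.perm_middle.trans ((List.perm_append_comm.cons x).trans List.perm_middle.symm)
  · exact List.Perm.refl _

theorem Factors.swap {x : ℤ} {A L R B : List ℤ} (h : Factors x A L R B) : Factors x A R L B :=
  ⟨h.right, h.left, h.last, h.head⟩

theorem notMem_of_nodup_word {x : ℤ} {A L R B : List ℤ} (h : (word A L x R B).Nodup) :
    x ∉ A ∧ x ∉ L ∧ x ∉ R ∧ x ∉ B := by
  unfold word at h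
  grind

theorem psi_perm {x : ℤ} (hx : x ≠ 0) {π : List ℤ} (hπ : π.Nodup) : (psi x π).Perm π := by
  by_cases h : x ∈ π
  · obtain ⟨A, L, R, B, rfl, hf⟩ := exists_factors h
    obtain ⟨h1, -, -, h2⟩ := notMem_of_nodup_word hπ
    rw [psi_word hx hf h1 h2]
    exact ((flip_perm L x R).append_left A).append_right B
  · rw [psi, if_neg h]

/-- `Factors` is symmetric in `L` and `R`, so the moved word comes already factored and the second
exchange undoes the first. -/
theorem psi_psi {x : ℤ} (hx : x ≠ 0) {π : List ℤ} (hπ : π.Nodup) : psi x (psi x π) = π := by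
  by_cases h : x ∈ π
  · obtain ⟨A, L, R, B, rfl, hf⟩ := exists_factors h
    obtain ⟨h1, -, -, h2⟩ := notMem_of_nodup_word hπ
    rw [psi_word hx hf h1 h2]
    rcases flip_flip (L := L) (x := x) (R := R) with ⟨e, e'⟩ | e
    · rw [e]
      change psi x (word A R x L B) = _
      rw [psi_word hx hf.swap h1 h2, e', word]
    · rw [e]
      change psi x (word A L x R B) = _
      rw [psi_word hx hf h1 h2, e, word]
  · rw [psi, psi, if_neg h, if_neg h]

theorem psi_of_notMem {x : ℤ} {π : List ℤ} (h : x ∉ π) : psi x π = π := by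
  rw [psi, if_neg h]

theorem psi_of_not_double {x : ℤ} {π : List ℤ} (h : ¬ IsDoubleDescent π x)
    (h' : ¬ IsDoubleAscent π x) : psi x π = π := by
  unfold psi
  simp [h, h']

theorem flip_reverse (L : List ℤ) (x : ℤ) (R : List ℤ) :
    (flip L x R).reverse = flip R.reverse x L.reverse := by
  unfold flip
  by_cases hL : L = [] <;> by_cases hR : R = [] <;> simp [hL, hR]

theorem Factors.reverse {x : ℤ} {A L R B : List ℤ} (h : Factors x A L R B) :
    Factors x B.reverse R.reverse L.reverse A.reverse := by
  refine ⟨by simpa using h.right, by simpa using h.left, ?_, ?_⟩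
  · rw [← headD_reverse, List.reverse_reverse]; exact h.head
  · rw [headD_reverse]; exact h.last

/-- The description by `flip` has left-right symmetry. This halves the case analyses below. -/
theorem psi_reverse {x : ℤ} (hx : x ≠ 0) {π : List ℤ} (hπ : π.Nodup) :
    psi x π.reverse = (psi x π).reverse := by
  by_cases h : x ∈ π
  · obtain ⟨A, L, R, B, rfl, hf⟩ := exists_factors h
    obtain ⟨h1, -, -, h2⟩ := notMem_of_nodup_word hπ
    have e : (word A L x R B).reverse = word B.reverse R.reverse x L.reverse A.reverse := by
      simp [word]
    rw [e, psi_word hx hf.reverse (by simpa using h2) (by simpa using h1), psi_word hx hf h1 h2]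
    simp [flip_reverse]
  · rw [psi_of_notMem h, psi_of_notMem (by simpa using h)]

/-- The map `ψ_x` acts within a stretch of the word bounded by letters not inside `x`. -/
theorem psi_append_append {x : ℤ} (hx : x ≠ 0) {C M D : List ℤ} (hM : M.Nodup)
    (hC : x ∉ C) (hD : x ∉ D) (h₁ : ¬ Inside x (C.getLastD 0)) (h₂ : ¬ Inside x (D.headD 0)) :
    psi x (C ++ M ++ D) = C ++ psi x M ++ D := by
  by_cases h : x ∈ M
  · obtain ⟨A, L, R, B, rfl, hf⟩ := exists_factors h
    obtain ⟨hA, -, -, hB⟩ := notMem_of_nodup_word hM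
    have e : C ++ word A L x R B ++ D = word (C ++ A) L x R (B ++ D) := by simp [word]
    have hf' : Factors x (C ++ A) L R (B ++ D) := by
      refine ⟨hf.left, hf.right, ?_, ?_⟩
      · rcases eq_or_ne A [] with rfl | hne
        · simpa using h₁
        · rw [getLastD_append C hne]; exact hf.last
      · rcases eq_or_ne B [] with rfl | hne
        · simpa using h₂
        · rw [headD_append D hne]; exact hf.head
    rw [e, psi_word hx hf' (by simp [hA, hC]) (by simp [hB, hD]), psi_word hx hf hA hB]
    simp
  · rw [psi_of_notMem h, psi_of_notMem (by simp [h, hC, hD])]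

/-- A new last letter can only come from the block of `x`. If `y` has the opposite sign, such a
letter is not inside `y`, so the runs next to `y` do not grow. -/
theorem getLastD_psi {x : ℤ} (hx : x ≠ 0) {π : List ℤ} (hπ : π.Nodup) :
    (psi x π).getLastD 0 = π.getLastD 0 ∨ (psi x π).getLastD 0 = x ∨
      Inside x ((psi x π).getLastD 0) := by
  by_cases h : x ∈ π
  · obtain ⟨A, L, R, B, rfl, hf⟩ := exists_factors h
    obtain ⟨hA, -, -, hB⟩ := notMem_of_nodup_word hπ
    rw [psi_word hx hf hA hB]
    rcases eq_or_ne B [] with rfl | hne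
    · right
      have hne : flip L x R ≠ [] := by
        intro e
        have := flip_perm L x R
        rw [e] at this
        simpa using this.length_eq
      rw [List.append_nil, getLastD_append A hne]
      have := (flip_perm L x R).mem_iff.1 (getLastD_mem hne 0)
      simp only [List.mem_append, List.mem_cons] at this
      rcases this with h | h | h
      · exact .inr (hf.left _ h)
      · exact .inl h
      · exact .inr (hf.right _ h)
    · left
      rw [word, getLastD_append _ hne, getLastD_append _ hne]
  · rw [psi_of_notMem h]; simp

/-! ### Commutation of the maps ψ_x. -/

/-- Nested case. A letter not inside `y` is not inside `x` either, and neither is `y` itself, so ψ_x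
acts within `L`, or within `A` without its last letter. That leaves the factorization around `y`
intact. -/
theorem psi_comm_of_inside_aux {x y : ℤ} (hx : x ≠ 0) (hy : y ≠ 0) (hxy : Inside y x)
    {A L R B : List ℤ} (hπ : (word A L y R B).Nodup) (hf : Factors y A L R B)
    (h : x ∈ A ∨ x ∈ L) :
    psi x (psi y (word A L y R B)) = psi y (psi x (word A L y R B)) := by
  obtain ⟨hyA, hyL, hyR, hyB⟩ := notMem_of_nodup_word hπ
  have out : ∀ {c : ℤ}, ¬ Inside y c → ¬ Inside x c := fun h h' => h (hxy.trans h')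
  have hny : ¬ Inside x y := fun h => (h.trans hxy).ne rfl
  rw [psi_word hy hf hyA hyB]
  rcases h with h | h
  · -- `x` is to the left of a letter not inside `y`
    have hA : A ≠ [] := List.ne_nil_of_mem h
    obtain ⟨A', c, rfl⟩ : ∃ A' c, A = A' ++ [c] := ⟨_, _, (List.dropLast_append_getLast hA).symm⟩
    have hc : ¬ Inside y c := by simpa using hf.last
    have hxc : x ≠ c := by rintro rfl; exact hc hxy
    have hxA : x ∈ A' := by simpa [hxc] using h
    have hnd : A'.Nodup := by unfold word at hπ; grind
    have loc : ∀ D : List ℤ, x ∉ D → psi x (A' ++ c :: D) = psi x A' ++ c :: D := by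
      intro D hD
      have := psi_append_append hx (C := []) (D := c :: D) hnd (by simp) (by simp [hD, hxc])
        (by simpa using not_inside_zero x) (by simpa using out hc)
      simpa using this
    have hxD : x ∉ flip L y R ++ B := by
      have := (flip_perm L y R).mem_iff (a := x)
      unfold word at hπ; grind
    have e1 : A' ++ [c] ++ flip L y R ++ B = A' ++ c :: (flip L y R ++ B) := by simp
    have e2 : word (A' ++ [c]) L y R B = A' ++ c :: (L ++ y :: R ++ B) := by simp [word]
    have hxD' : x ∉ L ++ y :: R ++ B := by
      unfold word at hπ; grind
    rw [e1, loc _ hxD, e2, loc _ hxD']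
    have e3 : psi x A' ++ c :: (L ++ y :: R ++ B) = word (psi x A' ++ [c]) L y R B := by
      simp [word]
    have hf' : Factors y (psi x A' ++ [c]) L R B :=
      ⟨hf.left, hf.right, by simpa using hc, hf.head⟩
    have hyA' : y ∉ psi x A' ++ [c] := by
      have := (psi_perm hx hnd).mem_iff (a := y)
      simp only [List.mem_append, this] at hyA ⊢
      exact hyA
    rw [e3, psi_word hy hf' hyA' hyB]
    simp
  -- The run `L` is bounded by the last letter of `A` and by `y`, or, once `y` has moved past it, by
  -- `y` and the head of `B`. None of these is inside `x`.
  · have hL : L ≠ [] := List.ne_nil_of_mem h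
    have hnd : L.Nodup := by unfold word at hπ; grind
    have hp := psi_perm hx hnd
    have hL' : psi x L ≠ [] := by
      intro e; rw [e] at hp; exact hL (by simpa using hp.symm)
    have hf' : Factors y A (psi x L) R B :=
      ⟨fun a ha => hf.left a (hp.mem_iff.1 ha), hf.right, hf.last, hf.head⟩
    have hxA : x ∉ A := by unfold word at hπ; grind
    have hxB : x ∉ B := by unfold word at hπ; grind
    have hxR : x ∉ y :: R := by unfold word at hπ; grind
    have e : psi x (word A L y R B) = word A (psi x L) y R B := by
      have := psi_append_append hx (C := A) (D := y :: R ++ B) hnd hxA (by grind)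
        (out hf.last) (by simpa using hny)
      simpa [word] using this
    rw [e, psi_word hy hf' hyA hyB]
    by_cases hR : R = []
    · subst hR
      have := psi_append_append hx (C := A ++ [y]) (D := B) hnd (by grind) hxB
        (by simpa using hny) (out hf.head)
      simpa [flip] using this
    · have := psi_append_append hx (C := A) (D := y :: R ++ B) hnd hxA (by grind)
        (out hf.last) (by simpa using hny)
      simpa [flip, hR, hL, hL'] using this

theorem psi_comm_of_inside {x y : ℤ} (hx : x ≠ 0) (hy : y ≠ 0) (hxy : Inside y x)
    {π : List ℤ} (hπ : π.Nodup) (hxm : x ∈ π) (hym : y ∈ π) :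
    psi x (psi y π) = psi y (psi x π) := by
  obtain ⟨A, L, R, B, rfl, hf⟩ := exists_factors hym
  by_cases h : x ∈ A ∨ x ∈ L
  · exact psi_comm_of_inside_aux hx hy hxy hπ hf h
  · have e : (word A L y R B).reverse = word B.reverse R.reverse y L.reverse A.reverse := by
      simp [word]
    have hπ' : (word A L y R B).reverse.Nodup := by simpa using hπ
    have := psi_comm_of_inside_aux hx hy hxy (e ▸ hπ') hf.reverse (by
      have := hxy.ne
      simp only [word, List.mem_append, List.mem_cons] at hxm
      simp only [List.mem_reverse]
      tauto)
    rw [← e, psi_reverse hx hπ, psi_reverse hy hπ,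
      psi_reverse hx ((psi_perm hy hπ).nodup_iff.2 hπ),
      psi_reverse hy ((psi_perm hx hπ).nodup_iff.2 hπ)] at this
    exact List.reverse_injective this

/-- All letters of the block of `y` have the sign of `y`, so in any arrangement that block stops the
runs of `x`, and ψ_x acts on `A` alone. -/
theorem psi_comm_of_neg_of_pos_aux {x y : ℤ} (hx : x ≠ 0) (hy : y ≠ 0)
    (hxy : x < 0 ∧ 0 < y ∨ 0 < x ∧ y < 0)
    {A L R B : List ℤ} (hπ : (word A L y R B).Nodup) (hf : Factors y A L R B) (h : x ∈ A) :
    psi x (psi y (word A L y R B)) = psi y (psi x (word A L y R B)) := by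
  obtain ⟨hyA, hyL, hyR, hyB⟩ := notMem_of_nodup_word hπ
  have opp : ∀ {c : ℤ}, (c = y ∨ Inside y c) → ¬ Inside x c := by
    intro c; unfold Inside; omega
  have opp' : ∀ {c : ℤ}, (c = x ∨ Inside x c) → ¬ Inside y c := by
    intro c; unfold Inside; omega
  have hnd : A.Nodup := by unfold word at hπ; grind
  have loc : ∀ M : List ℤ, M.Perm (L ++ y :: R) → psi x (A ++ M ++ B) = psi x A ++ M ++ B := by
    intro M hM
    have hne : M ≠ [] := by
      intro e; rw [e] at hM; simpa using hM.length_eq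
    have hmem := hM.mem_iff.1 (headD_mem hne 0)
    simp only [List.mem_append, List.mem_cons] at hmem
    have hxD : x ∉ M ++ B := by
      have := hM.mem_iff (a := x)
      unfold word at hπ; grind
    have := psi_append_append hx (C := []) (D := M ++ B) hnd (by simp) hxD
      (by simpa using not_inside_zero x) (by
        rw [headD_append B hne]
        apply opp
        rcases hmem with h | h | h
        · exact .inr (hf.left _ h)
        · exact .inl h
        · exact .inr (hf.right _ h))
    simpa using this
  have hf' : Factors y (psi x A) L R B := by
    refine ⟨hf.left, hf.right, ?_, hf.head⟩
    rcases getLastD_psi hx hnd with e | e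
    · rw [e]; exact hf.last
    · exact opp' e
  have hyA' : y ∉ psi x A := by rwa [(psi_perm hx hnd).mem_iff]
  rw [psi_word hy hf hyA hyB, loc _ (flip_perm L y R), word, loc _ (List.Perm.refl _)]
  exact (psi_word hy hf' hyA' hyB).symm

theorem psi_comm_of_neg_of_pos {x y : ℤ} (hx : x ≠ 0) (hy : y ≠ 0)
    (hxy : x < 0 ∧ 0 < y ∨ 0 < x ∧ y < 0)
    {π : List ℤ} (hπ : π.Nodup) (hxm : x ∈ π) (hym : y ∈ π) :
    psi x (psi y π) = psi y (psi x π) := by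
  obtain ⟨A, L, R, B, rfl, hf⟩ := exists_factors hym
  by_cases h : x ∈ A
  · exact psi_comm_of_neg_of_pos_aux hx hy hxy hπ hf h
  · have e : (word A L y R B).reverse = word B.reverse R.reverse y L.reverse A.reverse := by
      simp [word]
    have hπ' : (word A L y R B).reverse.Nodup := by simpa using hπ
    have := psi_comm_of_neg_of_pos_aux hx hy hxy (e ▸ hπ') hf.reverse (by
      have hL : x ∉ L := fun m => by
        have := hf.left x m
        unfold Inside at this; omega
      have hR : x ∉ R := fun m => by
        have := hf.right x m
        unfold Inside at this; omega
      simp only [word, List.mem_append, List.mem_cons] at hxm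
      simp only [List.mem_reverse]
      have : x ≠ y := by omega
      tauto)
    rw [← e, psi_reverse hx hπ, psi_reverse hy hπ,
      psi_reverse hx ((psi_perm hy hπ).nodup_iff.2 hπ),
      psi_reverse hy ((psi_perm hx hπ).nodup_iff.2 hπ)] at this
    exact List.reverse_injective this

/-- Of two distinct nonzero letters of the same sign one is inside the other, so the nested case and
the case of opposite signs cover everything. -/
theorem psi_comm {x y : ℤ} (hx : x ≠ 0) (hy : y ≠ 0) {π : List ℤ} (hπ : π.Nodup)
    (hxm : x ∈ π) (hym : y ∈ π) : psi x (psi y π) = psi y (psi x π) := by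
  by_cases h1 : Inside y x
  · exact psi_comm_of_inside hx hy h1 hπ hxm hym
  by_cases h2 : Inside x y
  · exact (psi_comm_of_inside hy hx h2 hπ hym hxm).symm
  rcases eq_or_ne x y with rfl | hne
  · rfl
  · refine psi_comm_of_neg_of_pos hx hy ?_ hπ hxm hym
    unfold Inside at h1 h2; omega

/-! ### Effect of ψ_x on ascents and descents. -/

theorem prev_ne {π : List ℤ} {y : ℤ} (hy : y ≠ 0) (hπ : π.Nodup) (hm : y ∈ π) :
    prev π y ≠ y := by
  obtain ⟨U, V, rfl⟩ := List.append_of_mem hm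
  have hU : y ∉ U := by grind
  rw [prev_append_cons V hU]
  rcases eq_or_ne U [] with rfl | hne
  · simpa using hy.symm
  · intro e; exact hU (e ▸ getLastD_mem hne 0)

theorem prev_reverse {π : List ℤ} {y : ℤ} (hπ : π.Nodup) (hm : y ∈ π) :
    prev π.reverse y = next π y := by
  obtain ⟨U, V, rfl⟩ := List.append_of_mem hm
  have hU : y ∉ U := by grind
  have hV : y ∉ V.reverse := by grind
  have e : (U ++ y :: V).reverse = V.reverse ++ y :: U.reverse := by simp
  rw [e, prev_append_cons _ hV, next_append_cons _ hU, ← headD_reverse, List.reverse_reverse]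

theorem next_reverse {π : List ℤ} {y : ℤ} (hπ : π.Nodup) (hm : y ∈ π) :
    next π.reverse y = prev π y := by
  rw [← prev_reverse (by simpa using hπ) (by simpa using hm), List.reverse_reverse]

theorem next_ne {π : List ℤ} {y : ℤ} (hy : y ≠ 0) (hπ : π.Nodup) (hm : y ∈ π) :
    next π y ≠ y := by
  rw [← prev_reverse hπ hm]
  exact prev_ne hy (by simpa using hπ) (by simpa using hm)

/-- Besides that of `x`, only two right neighbours change. The last letter of `A` gets the head of
`R` instead of `x`; it is not inside `x`, so it compares alike with both. The last letter of `R`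
gets `x` instead of the head of `B`; it is inside `x`, and neither of these is. -/
theorem lt_next_slide {x y : ℤ} (hx : x ≠ 0) {A R B : List ℤ} (hf : Factors x A [] R B)
    (hπ : (word A [] x R B).Nodup) (hR : R ≠ []) (hy : y ∈ word A [] x R B) (hyx : y ≠ x) :
    y < next (word A R x [] B) y ↔ y < next (word A [] x R B) y := by
  obtain ⟨hxA, -, hxR, hxB⟩ := notMem_of_nodup_word hπ
  have e1 : word A R x [] B = A ++ (R ++ x :: B) := by simp [word]
  have e2 : word A [] x R B = A ++ (x :: (R ++ B)) := by simp [word]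
  rw [e2] at hy hπ
  rw [e1, e2]
  have hhB : B.headD 0 ≠ x := by
    rcases eq_or_ne B [] with rfl | hne
    · simpa using hx.symm
    · intro e; exact hxB (e ▸ headD_mem hne 0)
  simp only [List.mem_append, List.mem_cons, hyx, false_or] at hy
  rcases hy with hy | hy | hy
  · obtain ⟨U, V, rfl⟩ := List.append_of_mem hy
    have hU : y ∉ U := by grind
    simp only [List.append_assoc, List.cons_append]
    rw [next_append_cons _ hU, next_append_cons _ hU]
    rcases eq_or_ne V [] with rfl | hne
    · simp only [List.nil_append, List.headD_cons]
      rw [headD_append _ hR]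
      have h1 := hf.right _ (headD_mem hR 0)
      have h2 : ¬ Inside x y := by simpa using hf.last
      unfold Inside at h1 h2; omega
    · rw [headD_append _ hne, headD_append _ hne]
  · obtain ⟨U, V, rfl⟩ := List.append_of_mem hy
    have hU : y ∉ A ++ U := by grind
    have hU' : y ∉ A ++ x :: U := by grind
    have e3 : A ++ (U ++ y :: V ++ x :: B) = (A ++ U) ++ y :: (V ++ x :: B) := by simp
    have e4 : A ++ x :: (U ++ y :: V ++ B) = (A ++ x :: U) ++ y :: (V ++ B) := by simp
    rw [e3, e4, next_append_cons _ hU, next_append_cons _ hU']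
    rcases eq_or_ne V [] with rfl | hne
    · simp only [List.nil_append, List.headD_cons]
      have h1 := hf.right y hy
      have h2 := hf.head
      unfold Inside at h1 h2; omega
    · rw [headD_append _ hne, headD_append _ hne]
  · obtain ⟨U, V, rfl⟩ := List.append_of_mem hy
    have hU : y ∉ A ++ R ++ x :: U := by grind
    have hU' : y ∉ A ++ x :: R ++ U := by grind
    have e3 : A ++ (R ++ x :: (U ++ y :: V)) = (A ++ R ++ x :: U) ++ y :: V := by simp
    have e4 : A ++ x :: (R ++ (U ++ y :: V)) = (A ++ x :: R ++ U) ++ y :: V := by simp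
    rw [e3, e4, next_append_cons _ hU, next_append_cons _ hU']

theorem lt_next_psi {x y : ℤ} (hx : x ≠ 0) {π : List ℤ} (hπ : π.Nodup) (hy : y ∈ π)
    (hyx : y ≠ x) : y < next (psi x π) y ↔ y < next π y := by
  by_cases h : x ∈ π
  · obtain ⟨A, L, R, B, rfl, hf⟩ := exists_factors h
    obtain ⟨hA, hL, hR, hB⟩ := notMem_of_nodup_word hπ
    rw [psi_word hx hf hA hB]
    rcases eq_or_ne L [] with rfl | hLne <;> rcases eq_or_ne R [] with rfl | hRne
    · simp [flip, word]
    · have := lt_next_slide hx hf hπ hRne hy hyx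
      simpa [flip, word] using this
    -- Here the given word is itself the result of sliding `x` to the right past `L`, so the slide
    -- is used backwards.
    · have hp : (word A [] x L B).Perm (word A L x [] B) := by
        simpa [word] using ((List.perm_middle (l₁ := L) (l₂ := B) (a := x)).symm).append_left A
      have := lt_next_slide hx hf.swap (hp.nodup_iff.2 hπ) hLne (hp.mem_iff.2 hy) hyx
      simpa [flip, word] using this.symm
    · simp [flip, word, hLne, hRne]
  · rw [psi_of_notMem h]

theorem prev_psi_lt {x y : ℤ} (hx : x ≠ 0) (hy0 : y ≠ 0) {π : List ℤ} (hπ : π.Nodup) (hy : y ∈ π)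
    (hyx : y ≠ x) : prev (psi x π) y < y ↔ prev π y < y := by
  have hp := psi_perm hx hπ
  have h := lt_next_psi hx (π := π.reverse) (by simpa using hπ) (by simpa using hy) hyx
  rw [psi_reverse hx hπ, next_reverse (hp.nodup_iff.2 hπ) (hp.mem_iff.2 hy),
    next_reverse hπ hy] at h
  have h1 := prev_ne hy0 hπ hy
  have h2 := prev_ne hy0 (hp.nodup_iff.2 hπ) (hp.mem_iff.2 hy)
  omega

theorem inside_prev_word {x : ℤ} {A L R B : List ℤ} (hf : Factors x A L R B)
    (hπ : (word A L x R B).Nodup) : Inside x (prev (word A L x R B) x) ↔ L ≠ [] := by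
  obtain ⟨hA, hL, -, -⟩ := notMem_of_nodup_word hπ
  have e : word A L x R B = (A ++ L) ++ x :: (R ++ B) := by simp [word]
  rw [e, prev_append_cons _ (by simp [hA, hL])]
  rcases eq_or_ne L [] with rfl | hne
  · simpa using hf.last
  · rw [getLastD_append A hne]
    simpa [hne] using hf.left _ (getLastD_mem hne 0)

theorem inside_next_word {x : ℤ} {A L R B : List ℤ} (hf : Factors x A L R B)
    (hπ : (word A L x R B).Nodup) : Inside x (next (word A L x R B) x) ↔ R ≠ [] := by
  obtain ⟨hA, hL, -, -⟩ := notMem_of_nodup_word hπ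
  have e : word A L x R B = (A ++ L) ++ x :: (R ++ B) := by simp [word]
  rw [e, next_append_cons _ (by simp [hA, hL])]
  rcases eq_or_ne R [] with rfl | hne
  · simpa using hf.head
  · rw [headD_append B hne]
    simpa [hne] using hf.right _ (headD_mem hne 0)

/-- A neighbour of `x` is inside `x` exactly when the run on that side is nonempty. Exchanging the
runs therefore reverses both comparisons of a double ascent or double descent. -/
theorem psi_double {x : ℤ} (hx : x ≠ 0) {π : List ℤ} (hπ : π.Nodup) (h : x ∈ π) :
    (IsDoubleDescent π x → IsDoubleAscent (psi x π) x) ∧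
      (IsDoubleAscent π x → IsDoubleDescent (psi x π) x) := by
  have hp := psi_perm hx hπ
  have hπ' := hp.nodup_iff.2 hπ
  have h' := hp.mem_iff.2 h
  have p1 := prev_ne hx hπ h
  have p2 := next_ne hx hπ h
  have p3 := prev_ne hx hπ' h'
  have p4 := next_ne hx hπ' h'
  unfold IsDoubleDescent IsDoubleAscent
  obtain ⟨A, L, R, B, rfl, hf⟩ := exists_factors h
  obtain ⟨hA, hL, hR, hB⟩ := notMem_of_nodup_word hπ
  have q1 := inside_prev_word hf hπ
  have q2 := inside_next_word hf hπ
  by_cases hflip : L = [] ∨ R = []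
  · have e : psi x (word A L x R B) = word A R x L B := by
      rw [psi_word hx hf hA hB, flip, if_pos hflip, word]
    rw [e] at hπ' p3 p4 ⊢
    have q3 := inside_prev_word hf.swap hπ'
    have q4 := inside_next_word hf.swap hπ'
    unfold Inside at *
    rcases eq_or_ne L [] with rfl | h1 <;> rcases eq_or_ne R [] with rfl | h2
    · simp only [ne_eq, not_true_eq_false, iff_false] at q1 q2 q3 q4
      omega
    · simp only [h2, ne_eq, not_true_eq_false, not_false_eq_true, iff_false, iff_true]
        at q1 q2 q3 q4
      omega
    · simp only [h1, ne_eq, not_true_eq_false, not_false_eq_true, iff_false, iff_true]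
        at q1 q2 q3 q4
      omega
    · exact absurd hflip (by simp [h1, h2])
  · push Not at hflip
    have q1 := q1.2 hflip.1
    have q2 := q2.2 hflip.2
    unfold Inside at *
    omega

/-! ### Rank functions and alternating signs of canonical labels. -/

section Chains

variable {P : Type*} [PartialOrder P]

omit [PartialOrder P] in
theorem signSum_append_pair (ω : P → ℤ) (l : List P) (u w : P) :
    signSum ω (l ++ [u, w]) = signSum ω (l ++ [u]) + if ω u < ω w then 1 else -1 := by
  induction l with
  | nil => simp [signSum]
  | cons a l ih =>
    cases l with
    | nil => simp [signSum]
    | cons b l =>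
      simp only [List.cons_append, signSum] at ih ⊢
      rw [ih]; ring

theorem IsSaturatedChainTo.append {c : List P} {u w : P} (h : IsSaturatedChainTo c u)
    (huw : u ⋖ w) (ω : P → ℤ) : IsSaturatedChainTo (c ++ [w]) w ∧
      signSum ω (c ++ [w]) = signSum ω c + if ω u < ω w then 1 else -1 := by
  obtain ⟨h1, h2, h3⟩ := h
  obtain ⟨c', rfl⟩ : ∃ c', c = c' ++ [u] := by
    rw [List.getLast?_eq_some_iff] at h3
    exact h3
  refine ⟨⟨?_, ?_, by simp⟩, ?_⟩
  · rw [List.isChain_append]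
    refine ⟨h1, by simp, ?_⟩
    simpa using huw
  · cases c' <;> simpa using h2
  · rw [List.append_assoc]
    exact signSum_append_pair ω c' u w

theorem isSaturatedChainTo_singleton {x : P} (h : IsMin x) : IsSaturatedChainTo [x] x :=
  ⟨by simp, by simpa using h, by simp⟩

theorem exists_isSaturatedChainTo [Finite P] (x : P) : ∃ c, IsSaturatedChainTo c x := by
  induction x using WellFoundedLT.induction with
  | _ x ih =>
    by_cases h : IsMin x
    · exact ⟨_, isSaturatedChainTo_singleton h⟩
    · obtain ⟨y, hy⟩ := exists_covBy_of_wellFoundedGT h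
      obtain ⟨c, hc⟩ := ih y hy.lt
      exact ⟨_, (hc.append hy fun _ => 0).1⟩

/-- `ρ` is a rank function of `(P, ω)`, which is sign-graded of rank `r`. -/
structure IsRankFunction (ω ρ : P → ℤ) (r : ℤ) : Prop where
  isMin : ∀ x, IsMin x → ρ x = 0
  isMax : ∀ x, IsMax x → ρ x = r
  covBy : ∀ x y, x ⋖ y → ρ y = ρ x + if ω x < ω y then 1 else -1

/-- Induction downwards from the maximal elements: two chains to `x` are extended by the same cover
`x ⋖ y`, which adds the same sign to both. -/
theorem IsSignGraded.signSum_eq [Finite P] {ω : P → ℤ} {r : ℤ} (h : IsSignGraded ω r) (x : P) :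
    ∀ c c', IsSaturatedChainTo c x → IsSaturatedChainTo c' x → signSum ω c = signSum ω c' := by
  induction x using WellFoundedGT.induction with
  | _ x ih =>
    intro c c' hc hc'
    by_cases hx : IsMax x
    · rw [h c x hc hx, h c' x hc' hx]
    · obtain ⟨y, hy⟩ := exists_covBy_of_wellFoundedLT hx
      obtain ⟨h1, h2⟩ := hc.append hy ω
      obtain ⟨h3, h4⟩ := hc'.append hy ω
      have := ih y hy.lt _ _ h1 h3
      rw [h2, h4] at this
      exact add_right_cancel this

theorem IsSignGraded.exists_isRankFunction [Finite P] {ω : P → ℤ} {r : ℤ}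
    (h : IsSignGraded ω r) : ∃ ρ : P → ℤ, IsRankFunction ω ρ r ∧ ∀ x, HasRank ω x (ρ x) := by
  choose c hc using fun x : P => exists_isSaturatedChainTo x
  refine ⟨fun x => signSum ω (c x), ⟨fun x hx => ?_, fun x hx => h _ x (hc x) hx,
    fun x y hxy => ?_⟩, fun x => ⟨c x, hc x, rfl⟩⟩
  · exact h.signSum_eq x _ _ (hc x) (isSaturatedChainTo_singleton hx)
  · obtain ⟨h1, h2⟩ := (hc x).append hxy ω
    rw [← h2]
    exact h.signSum_eq y _ _ (hc y) h1

/-- The signs of the labels alternate along saturated chains, starting with a negative sign at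
the minimal elements; `r` determines the sign at the maximal elements. -/
structure IsAlternating (ω : P → ℤ) (r : ℤ) : Prop where
  ne_zero : ∀ x, ω x ≠ 0
  isMin : ∀ x, IsMin x → ω x < 0
  covBy : ∀ x y, x ⋖ y → (ω x < 0 ↔ 0 < ω y)
  isMax : ∀ x, IsMax x → (r = 0 ∧ ω x < 0) ∨ (r = 1 ∧ 0 < ω x)

theorem IsRankFunction.isAlternating {ω ρ : P → ℤ} {r : ℤ} (h : IsRankFunction ω ρ r)
    (h01 : ∀ x, (ρ x = 0 ∧ ω x < 0) ∨ (ρ x = 1 ∧ 0 < ω x)) : IsAlternating ω r := by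
  refine ⟨fun x => ?_, fun x hx => ?_, fun x y hxy => ?_, fun x hx => ?_⟩
  · have := h01 x; omega
  · have := h01 x; have := h.isMin x hx; omega
  · have h1 := h01 x; have h2 := h01 y; have h3 := h.covBy x y hxy
    split_ifs at h3 <;> omega
  · have := h01 x; have := h.isMax x hx; omega

theorem IsSignGraded.isAlternating [Finite P] {ω : P → ℤ} {r : ℤ}
    (h : IsSignGraded ω r) (hc : IsCanonical ω) : IsAlternating ω r := by
  obtain ⟨ρ, h1, h2⟩ := h.exists_isRankFunction
  refine h1.isAlternating fun x => ?_
  obtain ⟨h3 | h3, h4, h5⟩ := hc x _ (h2 x)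
  · exact .inl ⟨h3, h4 h3⟩
  · exact .inr ⟨h3, h5 h3⟩

end Chains

/-! ### The action on the Jordan–Hölder set. -/

section JordanHolder

variable {P : Type*} [PartialOrder P] [Fintype P] {ω : P → ℤ}

/-- The relation between letters at increasing positions in a word of the Jordan–Hölder set. -/
def NotBelow (ω : P → ℤ) (a b : ℤ) : Prop := ∀ u v, ω u = a → ω v = b → ¬ v < u

omit [Fintype P] in
theorem pairwise_notBelow_iff (hω : Function.Injective ω) {π : List ℤ} (h1 : π.Nodup) (h2 : ∀ u, ω u ∈ π) :
    π.Pairwise (NotBelow ω) ↔ ∀ x y, x < y → π.idxOf (ω x) < π.idxOf (ω y) := by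
  rw [List.pairwise_iff_getElem]
  constructor
  · intro h x y hxy
    have hx := List.idxOf_lt_length_iff.2 (h2 x)
    have hy := List.idxOf_lt_length_iff.2 (h2 y)
    by_contra! hle
    rcases hle.lt_or_eq with hlt | heq
    · exact h _ _ hy hx hlt y x (List.getElem_idxOf hy).symm (List.getElem_idxOf hx).symm hxy
    · exact hxy.ne' (hω ((List.idxOf_inj (h2 y)).1 heq))
  · intro h i j hi hj hij u v hu hv hvu
    have := h v u hvu
    rw [hu, hv, h1.idxOf_getElem, h1.idxOf_getElem] at this
    omega

theorem mem_jordanHolder (hω : Function.Injective ω) {π : List ℤ} : π ∈ jordanHolder ω ↔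
    π.Nodup ∧ (∀ a, a ∈ π ↔ ∃ u, ω u = a) ∧ π.Pairwise (NotBelow ω) := by
  classical
  have key : (π.Nodup ∧ ∀ a, a ∈ π ↔ ∃ u, ω u = a) ↔
      (Finset.univ.image ω).val = (π : Multiset ℤ) := by
    constructor
    · rintro ⟨h1, h2⟩
      rw [Multiset.Nodup.ext (Finset.nodup _) (Multiset.coe_nodup.2 h1)]
      intro a
      simp [h2]
    · intro h
      refine ⟨Multiset.coe_nodup.1 (h ▸ Finset.nodup _), fun a => ?_⟩
      rw [← Multiset.mem_coe, ← h]
      simp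
  unfold jordanHolder
  rw [Finset.mem_filter, Multiset.mem_toFinset, Multiset.mem_lists_iff, ← and_assoc]
  rw [key]
  constructor
  · rintro ⟨h1, h2⟩
    have h1' : (Finset.univ.image ω).val = (π : Multiset ℤ) := h1
    obtain ⟨h3, h4⟩ := key.2 h1'
    refine ⟨h1', (pairwise_notBelow_iff hω h3 fun u => (h4 _).2 ⟨u, rfl⟩).2 ?_⟩
    exact h2
  · rintro ⟨h1, h2⟩
    obtain ⟨h3, h4⟩ := key.2 h1
    rw [pairwise_notBelow_iff hω h3 fun u => (h4 _).2 ⟨u, rfl⟩] at h2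
    refine ⟨?_, ?_⟩
    · exact h1
    · exact h2

end JordanHolder

section JordanHolder

variable {P : Type*} [PartialOrder P] [Fintype P] {ω : P → ℤ} {r : ℤ}

theorem nodup_of_mem_jordanHolder (hω : Function.Injective ω) {π : List ℤ}
    (h : π ∈ jordanHolder ω) : π.Nodup := ((mem_jordanHolder hω).1 h).1

theorem apply_mem_of_mem_jordanHolder (hω : Function.Injective ω) {π : List ℤ}
    (h : π ∈ jordanHolder ω) (x : P) : ω x ∈ π := (((mem_jordanHolder hω).1 h).2.1 _).2 ⟨x, rfl⟩

omit [Fintype P] in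
theorem not_lt_of_pairwise_notBelow {U V : List ℤ} (h : (U ++ V).Pairwise (NotBelow ω)) {u w : P}
    (hw : ω w ∈ U) (hu : ω u ∈ V) : ¬ u < w :=
  (List.pairwise_append.1 h).2.2 _ hw _ hu w u rfl rfl

/-- If `x < v` with the label of `v` in `R`, choose `x ⋖ w ≤ v`. The label of `w` has the opposite
sign, so `w ≠ v` and it is not in `R`; but a linear extension must place `w` between `x` and `v`,
that is, in `R`. -/
theorem IsAlternating.notBelow_of_mem_right (hω : Function.Injective ω) (h : IsAlternating ω r)
    {x : P} {A R B : List ℤ} (hmem : ∀ u, ω u ∈ A ++ ω x :: (R ++ B))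
    (hp : (A ++ ω x :: (R ++ B)).Pairwise (NotBelow ω)) (hR : ∀ a ∈ R, Inside (ω x) a) :
    ∀ b ∈ R, NotBelow ω b (ω x) := by
  rintro b hb v u rfl hu hxv
  obtain rfl := hω hu
  obtain ⟨w, huw, hwv⟩ := exists_covBy_le_of_lt hxv
  have h1 := hR _ hb
  have h2 := h.covBy u w huw
  have hne : w ≠ v := by
    rintro rfl
    unfold Inside at h1; omega
  have hwv := lt_of_le_of_ne hwv hne
  have hwx : ω w ≠ ω u := fun e => huw.lt.ne' (hω e)
  have hwv' : ω w ≠ ω v := fun e => hne (hω e)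
  have hwR : ω w ∉ R := by
    intro hw
    have h4 := hR _ hw
    have := h.ne_zero u
    unfold Inside at h1 h4; omega
  have hwA : ω w ∉ A := fun hw => not_lt_of_pairwise_notBelow hp hw (by simp) huw.lt
  have hwB : ω w ∉ B := fun hw => by
    have e : A ++ ω u :: (R ++ B) = (A ++ ω u :: R) ++ B := by simp
    rw [e] at hp
    exact not_lt_of_pairwise_notBelow hp (by simp [hb]) hw hwv
  have := hmem w
  simp [hwA, hwB, hwR, hwx] at this

theorem IsAlternating.notBelow_of_mem_left (hω : Function.Injective ω) (h : IsAlternating ω r)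
    {x : P} {A L B : List ℤ} (hmem : ∀ u, ω u ∈ (A ++ L) ++ ω x :: B)
    (hp : ((A ++ L) ++ ω x :: B).Pairwise (NotBelow ω)) (hL : ∀ a ∈ L, Inside (ω x) a) :
    ∀ b ∈ L, NotBelow ω (ω x) b := by
  rintro b hb u v hu rfl hvx
  obtain rfl := hω hu
  obtain ⟨w, hvw, hwu⟩ := exists_le_covBy_of_lt hvx
  have h1 := hL _ hb
  have h2 := h.covBy w u hwu
  have hne : v ≠ w := by
    rintro rfl
    unfold Inside at h1; omega
  have hvw := lt_of_le_of_ne hvw hne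
  have hwx : ω w ≠ ω u := fun e => hwu.lt.ne (hω e)
  have hwL : ω w ∉ L := by
    intro hw
    have h4 := hL _ hw
    have := h.ne_zero u
    unfold Inside at h1 h4; omega
  have hwA : ω w ∉ A := fun hw => by
    rw [List.append_assoc] at hp
    exact not_lt_of_pairwise_notBelow hp hw (by simp [hb]) hvw
  have hwB : ω w ∉ B := fun hw => by
    have e : (A ++ L) ++ ω u :: B = (A ++ L ++ [ω u]) ++ B := by simp
    rw [e] at hp
    exact not_lt_of_pairwise_notBelow hp (by simp) hw hwu.lt
  have := hmem w
  simp [hwA, hwB, hwL, hwx] at this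

theorem IsAlternating.psi_mem (hω : Function.Injective ω) (h : IsAlternating ω r) (x : P)
    {π : List ℤ} (hπ : π ∈ jordanHolder ω) : psi (ω x) π ∈ jordanHolder ω := by
  have hmem := apply_mem_of_mem_jordanHolder hω hπ
  rw [mem_jordanHolder hω] at hπ ⊢
  obtain ⟨hnd, hm, hp⟩ := hπ
  have hperm := psi_perm (h.ne_zero x) hnd
  refine ⟨hperm.nodup_iff.2 hnd, fun a => hperm.mem_iff.trans (hm a), ?_⟩
  obtain ⟨A, L, R, B, rfl, hf⟩ := exists_factors (hmem x)
  obtain ⟨hA, hL, hR, hB⟩ := notMem_of_nodup_word hnd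
  rw [psi_word (h.ne_zero x) hf hA hB]
  rcases eq_or_ne L [] with rfl | hLne
  · have e : word A [] (ω x) R B = A ++ ω x :: (R ++ B) := by simp [word]
    rw [e] at hp
    have key := h.notBelow_of_mem_right hω (e ▸ hmem) hp hf.right
    have e : A ++ flip [] (ω x) R ++ B = A ++ (R ++ ω x :: B) := by simp [flip]
    rw [e]
    simp only [List.pairwise_append, List.pairwise_cons, List.mem_append, List.mem_cons] at hp ⊢
    grind
  rcases eq_or_ne R [] with rfl | hRne
  · have e : word A L (ω x) [] B = (A ++ L) ++ ω x :: B := by simp [word]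
    rw [e] at hp
    have key := h.notBelow_of_mem_left hω (e ▸ hmem) hp hf.left
    have e : A ++ flip L (ω x) [] ++ B = A ++ (ω x :: (L ++ B)) := by simp [flip]
    rw [e]
    simp only [List.pairwise_append, List.pairwise_cons, List.mem_append, List.mem_cons] at hp ⊢
    grind
  · simpa [flip, hLne, hRne, word] using hp

theorem IsAlternating.psi_comm (hω : Function.Injective ω) (h : IsAlternating ω r) (x y : P)
    {π : List ℤ} (hπ : π ∈ jordanHolder ω) :
    psi (ω x) (psi (ω y) π) = psi (ω y) (psi (ω x) π) :=
  SignGraded.psi_comm (h.ne_zero x) (h.ne_zero y) (nodup_of_mem_jordanHolder hω hπ)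
    (apply_mem_of_mem_jordanHolder hω hπ x) (apply_mem_of_mem_jordanHolder hω hπ y)

theorem IsAlternating.psi_psi (hω : Function.Injective ω) (h : IsAlternating ω r) (x : P)
    {π : List ℤ} (hπ : π ∈ jordanHolder ω) : psi (ω x) (psi (ω x) π) = π :=
  SignGraded.psi_psi (h.ne_zero x) (nodup_of_mem_jordanHolder hω hπ)

/-- Frees `psiSet` from the order of composition fixed in its definition. -/
theorem foldr_psi_perm (hω : Function.Injective ω) (h : IsAlternating ω r) {l l' : List ℤ}
    (hl : l.Perm l') (hmem : ∀ a ∈ l, ∃ x, ω x = a) {π : List ℤ} (hπ : π ∈ jordanHolder ω) :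
    l.foldr psi π = l'.foldr psi π ∧ l.foldr psi π ∈ jordanHolder ω := by
  induction hl with
  | nil => exact ⟨rfl, hπ⟩
  | cons a hl ih =>
    obtain ⟨h1, h2⟩ := ih fun b hb => hmem b (by simp [hb])
    obtain ⟨x, rfl⟩ := hmem a (by simp)
    exact ⟨by simp [h1], h.psi_mem hω x h2⟩
  | swap a b l =>
    have h2 : l.foldr psi π ∈ jordanHolder ω := by
      have hmem' : ∀ c ∈ l, ∃ x, ω x = c := fun c hc => hmem c (by simp [hc])
      clear hmem
      induction l with
      | nil => exact hπ
      | cons c l ih =>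
        obtain ⟨x, rfl⟩ := hmem' c (by simp)
        exact h.psi_mem hω x (ih fun c hc => hmem' c (by simp [hc]))
    obtain ⟨x, rfl⟩ := hmem a (by simp)
    obtain ⟨y, rfl⟩ := hmem b (by simp)
    exact ⟨h.psi_comm hω _ _ h2, h.psi_mem hω _ (h.psi_mem hω _ h2)⟩
  | trans h1 h2 ih1 ih2 =>
    obtain ⟨h3, h4⟩ := ih1 hmem
    obtain ⟨h5, -⟩ := ih2 fun a ha => hmem a (h1.mem_iff.2 ha)
    exact ⟨h3.trans h5, h4⟩

omit [PartialOrder P] [Fintype P] in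
theorem psiSet_empty (π : List ℤ) : psiSet ω ∅ π = π := by simp [psiSet]

theorem psiSet_mem (hω : Function.Injective ω) (h : IsAlternating ω r) (S : Finset P)
    {π : List ℤ} (hπ : π ∈ jordanHolder ω) : psiSet ω S π ∈ jordanHolder ω :=
  (foldr_psi_perm hω h (List.Perm.refl _) (by simp) hπ).2

theorem psiSet_insert [DecidableEq P] (hω : Function.Injective ω) (h : IsAlternating ω r)
    {S : Finset P} {x : P} (hx : x ∉ S) {π : List ℤ} (hπ : π ∈ jordanHolder ω) :
    psiSet ω (insert x S) π = psi (ω x) (psiSet ω S π) := by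
  have hp : (((insert x S).image ω).sort (· ≤ ·)).Perm (ω x :: (S.image ω).sort (· ≤ ·)) := by
    rw [List.perm_ext_iff_of_nodup (Finset.sort_nodup _ _)]
    · simp
    · rw [List.nodup_cons]
      exact ⟨by simpa [hω.eq_iff] using hx, Finset.sort_nodup _ _⟩
  exact (foldr_psi_perm hω h hp (by simp) hπ).1

theorem psi_psiSet [DecidableEq P] (hω : Function.Injective ω) (h : IsAlternating ω r)
    (S : Finset P) (x : P) {π : List ℤ} (hπ : π ∈ jordanHolder ω) :
    psi (ω x) (psiSet ω S π) = psiSet ω (symmDiff {x} S) π := by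
  by_cases hx : x ∈ S
  · have e : insert x (symmDiff {x} S) = S := by
      ext y; simp only [Finset.mem_insert, Finset.mem_symmDiff, Finset.mem_singleton]
      by_cases hy : y = x
      · simp [hy, hx]
      · simp [hy]
    conv_lhs => rw [← e]
    rw [psiSet_insert hω h (by simp [Finset.mem_symmDiff, hx]) hπ,
      h.psi_psi hω x (psiSet_mem hω h _ hπ)]
  · rw [← psiSet_insert hω h hx hπ]
    congr 1
    ext y; simp only [Finset.mem_insert, Finset.mem_symmDiff, Finset.mem_singleton]
    by_cases hy : y = x
    · simp [hy, hx]
    · simp [hy]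

/-- Commuting involutions compose by symmetric difference of index sets; this is the action of ℤ₂^P.
-/
theorem psiSet_psiSet [DecidableEq P] (hω : Function.Injective ω) (h : IsAlternating ω r)
    (S T : Finset P) {π : List ℤ} (hπ : π ∈ jordanHolder ω) :
    psiSet ω S (psiSet ω T π) = psiSet ω (symmDiff S T) π := by
  induction S using Finset.induction_on with
  | empty =>
    rw [psiSet_empty]
    congr 1
    exact (bot_symmDiff T).symm
  | insert x S hx ih =>
    rw [psiSet_insert hω h hx (psiSet_mem hω h T hπ), ih, psi_psiSet hω h _ x hπ, ← symmDiff_assoc]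
    congr 2
    ext y; simp only [Finset.mem_insert, Finset.mem_symmDiff, Finset.mem_singleton]
    by_cases hy : y = x
    · simp [hy, hx]
    · simp [hy]

end JordanHolder

/-! ### Counting letters by their neighbours. -/

/-- The number of letters `y` of a word, preceded by the letter `a` and followed by `0`, that
satisfy `Q` together with their left and right neighbours. -/
def letterCount (Q : ℤ → ℤ → ℤ → Bool) : ℤ → List ℤ → ℕ
  | _, [] => 0
  | a, y :: l => (if Q a y (l.headD 0) then 1 else 0) + letterCount Q y l

theorem letterCount_eq_countP (Q : ℤ → ℤ → ℤ → Bool) (l : List ℤ) : ∀ U : List ℤ, (U ++ l).Nodup →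
    letterCount Q (U.getLastD 0) l =
      l.countP fun y => Q (prev (U ++ l) y) y (next (U ++ l) y) := by
  induction l with
  | nil => intro U _; simp [letterCount]
  | cons y l ih =>
    intro U h
    have hy : y ∉ U := by grind
    have e : U ++ y :: l = (U ++ [y]) ++ l := by simp
    have := ih (U ++ [y]) (e ▸ h)
    rw [← e] at this
    rw [List.countP_cons, ← this, letterCount, prev_append_cons l hy, next_append_cons l hy]
    simp [add_comm]

/-- Each descent is charged to its left end; the one starting at `a` is listed apart. -/
theorem des_cons_append (a : ℤ) (l : List ℤ) :
    des (a :: (l ++ [0])) = (if l.headD 0 < a then 1 else 0) +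
      letterCount (fun _ y n => n < y) a l := by
  induction l generalizing a with
  | nil => simp [des, letterCount]
  | cons y l ih =>
    rw [List.cons_append, des, ih, letterCount]
    simp

/-- Each descent is charged to its right end; the one ending at the closing 0 is listed apart. -/
theorem des_cons_append' (a : ℤ) (l : List ℤ) :
    des (a :: (l ++ [0])) = letterCount (fun p y _ => y < p) a l +
      (if 0 < l.getLastD a then 1 else 0) := by
  induction l generalizing a with
  | nil => simp [des, letterCount]
  | cons y l ih =>
    rw [List.cons_append, des, ih, letterCount]
    simp only [List.getLastD_cons, add_assoc, decide_eq_true_eq]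

theorem des_cons_append'' (a : ℤ) (l : List ℤ) :
    des (a :: (l ++ [0])) = des (a :: l) + (if 0 < l.getLastD a then 1 else 0) := by
  induction l generalizing a with
  | nil => simp [des]
  | cons y l ih =>
    rw [List.cons_append, des, ih, des]
    simp only [List.getLastD_cons, add_assoc]

theorem innerPeaks_cons_append (a : ℤ) (l : List ℤ) :
    innerPeaks (a :: (l ++ [0])) = letterCount (fun p y n => p < y ∧ n < y) a l := by
  induction l generalizing a with
  | nil => simp [innerPeaks, letterCount]
  | cons y l ih =>
    rw [letterCount, ← ih]
    cases l with
    | nil => simp [innerPeaks]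
    | cons z l => simp [innerPeaks]

section JordanHolder

variable {P : Type*} [PartialOrder P] [Fintype P] {ω : P → ℤ} {r : ℤ}

theorem letterCount_eq_card (hω : Function.Injective ω) {π : List ℤ}
    (hπ : π ∈ jordanHolder ω) (Q : ℤ → ℤ → ℤ → Bool) :
    letterCount Q 0 π =
      (Finset.univ.filter fun x => Q (prev π (ω x)) (ω x) (next π (ω x)) = true).card := by
  obtain ⟨h1, h2, -⟩ := (mem_jordanHolder hω).1 hπ
  have := letterCount_eq_countP Q π [] (by simpa using h1)
  simp only [List.getLastD_nil, List.nil_append] at this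
  rw [this, List.countP_eq_length_filter, ← List.toFinset_card_of_nodup (h1.filter _),
    ← Finset.card_image_of_injective _ hω]
  congr 1
  ext a
  simp only [List.mem_toFinset, List.mem_filter, h2, Finset.mem_image, Finset.mem_filter,
    Finset.mem_univ, true_and]
  grind

/-- The elements whose labels are double descents of `π`. -/
def ddSet (ω : P → ℤ) (π : List ℤ) : Finset P := {x | IsDoubleDescent π (ω x)}

/-- The elements whose labels are double descents or double ascents of `π`. -/
def freeSet (ω : P → ℤ) (π : List ℤ) : Finset P :=
  {x | IsDoubleDescent π (ω x) ∨ IsDoubleAscent π (ω x)}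

/-- The elements whose labels are peaks of `π`. -/
def peakSet (ω : P → ℤ) (π : List ℤ) : Finset P :=
  {x | prev π (ω x) < ω x ∧ next π (ω x) < ω x}

omit [PartialOrder P] in
theorem mem_ddSet {π : List ℤ} {x : P} :
    x ∈ ddSet ω π ↔ ω x < prev π (ω x) ∧ next π (ω x) < ω x := by
  rw [ddSet, Finset.mem_filter_univ, IsDoubleDescent]

omit [PartialOrder P] in
theorem mem_freeSet {π : List ℤ} {x : P} : x ∈ freeSet ω π ↔
    (ω x < prev π (ω x) ∧ next π (ω x) < ω x) ∨ prev π (ω x) < ω x ∧ ω x < next π (ω x) := by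
  rw [freeSet, Finset.mem_filter_univ, IsDoubleDescent, IsDoubleAscent]

omit [PartialOrder P] in
theorem mem_peakSet {π : List ℤ} {x : P} :
    x ∈ peakSet ω π ↔ prev π (ω x) < ω x ∧ next π (ω x) < ω x := by
  rw [peakSet, Finset.mem_filter_univ]

theorem peak_eq_card (hω : Function.Injective ω) {π : List ℤ} (hπ : π ∈ jordanHolder ω) :
    peak π = (peakSet ω π).card := by
  have : peak π = innerPeaks (0 :: (π ++ [0])) := rfl
  rw [this, innerPeaks_cons_append, letterCount_eq_card hω hπ]
  simp [peakSet]

theorem exists_isMin_head (hω : Function.Injective ω) {a : ℤ} {l : List ℤ}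
    (hπ : a :: l ∈ jordanHolder ω) : ∃ u, ω u = a ∧ IsMin u := by
  obtain ⟨h1, h2, h3⟩ := (mem_jordanHolder hω).1 hπ
  obtain ⟨u, rfl⟩ := (h2 a).1 (by simp)
  refine ⟨u, rfl, isMin_iff_forall_not_lt.2 fun v hv => ?_⟩
  have hm := (h2 (ω v)).2 ⟨v, rfl⟩
  have hne : ω v ≠ ω u := fun e => hv.ne (hω e)
  exact (List.pairwise_cons.1 h3).1 (ω v) (by simpa [hne] using hm) u v rfl rfl hv

theorem exists_isMax_last (hω : Function.Injective ω) {a : ℤ} {l : List ℤ}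
    (hπ : l ++ [a] ∈ jordanHolder ω) : ∃ u, ω u = a ∧ IsMax u := by
  obtain ⟨h1, h2, h3⟩ := (mem_jordanHolder hω).1 hπ
  obtain ⟨u, rfl⟩ := (h2 a).1 (by simp)
  refine ⟨u, rfl, isMax_iff_forall_not_lt.2 fun v hv => ?_⟩
  have hm := (h2 (ω v)).2 ⟨v, rfl⟩
  have hne : ω v ≠ ω u := fun e => hv.ne' (hω e)
  exact not_lt_of_pairwise_notBelow h3 (w := v) (by simpa [hne] using hm)
    (by simp : ω u ∈ [ω u]) hv

theorem ne_nil_of_mem_jordanHolder [Nonempty P] (hω : Function.Injective ω) {π : List ℤ}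
    (hπ : π ∈ jordanHolder ω) : π ≠ [] :=
  List.ne_nil_of_mem (apply_mem_of_mem_jordanHolder hω hπ (Classical.arbitrary P))

theorem IsAlternating.des_counts [Nonempty P] (hω : Function.Injective ω) (h : IsAlternating ω r)
    {π : List ℤ} (hπ : π ∈ jordanHolder ω) :
    (des π + r = (ddSet ω π).card + (peakSet ω π).card) ∧
      ((freeSet ω π).card : ℤ) + 2 * (des π - (ddSet ω π).card) = Fintype.card P - r - 1 := by
  classical
  have hnd := nodup_of_mem_jordanHolder hω hπ
  have hmem := apply_mem_of_mem_jordanHolder hω hπ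
  have hpn := fun x => prev_ne (h.ne_zero x) hnd (hmem x)
  have hnn := fun x => next_ne (h.ne_zero x) hnd (hmem x)
  have hne := ne_nil_of_mem_jordanHolder hω hπ
  have e1 := des_cons_append 0 π
  have e2 := des_cons_append' 0 π
  have e3 : des (0 :: (π ++ [0])) = 1 + des π + (if 0 < π.getLastD 0 then 1 else 0) := by
    rw [des_cons_append'']
    congr 1
    obtain ⟨a, l, rfl⟩ := List.exists_cons_of_ne_nil hne
    obtain ⟨u, rfl, hu⟩ := exists_isMin_head hω hπ
    rw [des, if_pos (h.isMin u hu)]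
  have e4 : π.headD 0 < 0 := by
    obtain ⟨a, l, rfl⟩ := List.exists_cons_of_ne_nil hne
    obtain ⟨u, rfl, hu⟩ := exists_isMin_head hω hπ
    exact h.isMin u hu
  -- The last letter labels a maximal element, so its sign is dictated by `r`.
  have e5 : r = if 0 < π.getLastD 0 then 1 else 0 := by
    obtain ⟨l, a, rfl⟩ : ∃ l a, π = l ++ [a] := ⟨_, _, (List.dropLast_append_getLast hne).symm⟩
    obtain ⟨u, rfl, hu⟩ := exists_isMax_last hω hπ
    have := h.isMax u hu
    simp only [List.getLastD_concat]
    split_ifs <;> omega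
  rw [if_pos e4, letterCount_eq_card hω hπ] at e1
  rw [letterCount_eq_card hω hπ] at e2
  set V : Finset P := {x | ω x < prev π (ω x) ∧ ω x < next π (ω x)} with hV
  have c1 : (Finset.univ.filter fun x => decide (next π (ω x) < ω x) = true).card =
      (ddSet ω π).card + (peakSet ω π).card := by
    rw [← Finset.card_union_of_disjoint]
    · congr 1
      ext x
      have := hpn x
      simp only [Finset.mem_filter, Finset.mem_univ, true_and, Finset.mem_union, mem_ddSet, mem_peakSet,
        decide_eq_true_eq]
      omega
    · rw [Finset.disjoint_left]
      intro x
      simp only [mem_ddSet, mem_peakSet]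
      omega
  have c2 : (Finset.univ.filter fun x => decide (ω x < prev π (ω x)) = true).card =
      (ddSet ω π).card + V.card := by
    rw [← Finset.card_union_of_disjoint]
    · congr 1
      ext x
      have := hnn x
      simp only [Finset.mem_filter, Finset.mem_univ, true_and, Finset.mem_union, mem_ddSet, hV,
        decide_eq_true_eq]
      omega
    · rw [Finset.disjoint_left]
      intro x
      simp only [mem_ddSet, hV, Finset.mem_filter, Finset.mem_univ, true_and]
      omega
  have c3 : Fintype.card P = (freeSet ω π).card + ((peakSet ω π).card + V.card) := by
    rw [← Finset.card_union_of_disjoint, ← Finset.card_union_of_disjoint, ← Finset.card_univ]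
    · congr 1
      ext x
      have := hnn x
      have := hpn x
      simp only [Finset.mem_filter, Finset.mem_univ, true_and, Finset.mem_union, mem_freeSet, hV,
        mem_peakSet, true_iff]
      omega
    · rw [Finset.disjoint_left]
      intro x
      simp only [mem_freeSet, mem_peakSet, hV, Finset.mem_filter, Finset.mem_univ, true_and,
        Finset.mem_union]
      omega
    · rw [Finset.disjoint_left]
      intro x
      simp only [mem_peakSet, hV, Finset.mem_filter, Finset.mem_univ, true_and]
      omega
  rw [c1] at e1
  rw [c2] at e2
  -- With D, K, V, F the numbers of double descents, peaks, valleys and free letters, `0 π 0` has 1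
  -- + des + r = 1 + D + K = D + V + r descents, and p = F + K + V. Eliminating K and V gives the
  -- second claim.
  split_ifs at e2 e3 e5 <;> omega

/-- All letters other than `x` keep their type. A free `x` changes between double descent and double
ascent, and for any other `x` the word is fixed. -/
theorem IsAlternating.psi_sets [DecidableEq P] (hω : Function.Injective ω) (h : IsAlternating ω r)
    (x : P) {π : List ℤ} (hπ : π ∈ jordanHolder ω) :
    freeSet ω (psi (ω x) π) = freeSet ω π ∧ peakSet ω (psi (ω x) π) = peakSet ω π ∧
      ddSet ω (psi (ω x) π) = symmDiff ({x} ∩ freeSet ω π) (ddSet ω π) := by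
  have hnd := nodup_of_mem_jordanHolder hω hπ
  have hmem := apply_mem_of_mem_jordanHolder hω hπ
  have hnd' := nodup_of_mem_jordanHolder hω (h.psi_mem hω x hπ)
  have hmem' := apply_mem_of_mem_jordanHolder hω (h.psi_mem hω x hπ)
  have hpn := fun y => prev_ne (h.ne_zero y) hnd (hmem y)
  have hnn := fun y => next_ne (h.ne_zero y) hnd (hmem y)
  have hpn' := fun y => prev_ne (h.ne_zero y) hnd' (hmem' y)
  have hnn' := fun y => next_ne (h.ne_zero y) hnd' (hmem' y)
  have key : ∀ y, y ≠ x →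
      (prev (psi (ω x) π) (ω y) < ω y ↔ prev π (ω y) < ω y) ∧
      (ω y < next (psi (ω x) π) (ω y) ↔ ω y < next π (ω y)) := fun y hy =>
    ⟨prev_psi_lt (h.ne_zero x) (h.ne_zero y) hnd (hmem y) fun e => hy (hω e),
      lt_next_psi (h.ne_zero x) hnd (hmem y) fun e => hy (hω e)⟩
  obtain ⟨k1, k2⟩ := psi_double (h.ne_zero x) hnd (hmem x)
  have k3 : ¬ IsDoubleDescent π (ω x) → ¬ IsDoubleAscent π (ω x) → psi (ω x) π = π :=
    psi_of_not_double
  have dec : ∀ y, y = x ∨ y ≠ x := fun y => eq_or_ne y x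
  refine ⟨?_, ?_, ?_⟩
  · ext y
    have := hpn y; have := hnn y; have := hpn' y; have := hnn' y
    simp only [freeSet, Finset.mem_filter, Finset.mem_univ, true_and]
    rcases dec y with rfl | hy
    · by_cases h1 : IsDoubleDescent π (ω y)
      · simp [h1, k1 h1]
      by_cases h2 : IsDoubleAscent π (ω y)
      · simp [h2, k2 h2]
      rw [k3 h1 h2]
    · have := key y hy
      unfold IsDoubleDescent IsDoubleAscent
      omega
  · ext y
    have := hpn y; have := hnn y; have := hpn' y; have := hnn' y
    simp only [peakSet, Finset.mem_filter, Finset.mem_univ, true_and]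
    rcases dec y with rfl | hy
    · by_cases h1 : IsDoubleDescent π (ω y)
      · have := k1 h1
        unfold IsDoubleDescent IsDoubleAscent at *
        omega
      by_cases h2 : IsDoubleAscent π (ω y)
      · have := k2 h2
        unfold IsDoubleDescent IsDoubleAscent at *
        omega
      rw [k3 h1 h2]
    · have := key y hy
      omega
  · ext y
    have := hpn y; have := hnn y; have := hpn' y; have := hnn' y
    simp only [ddSet, freeSet, Finset.mem_filter, Finset.mem_univ, true_and, Finset.mem_symmDiff,
      Finset.mem_inter, Finset.mem_singleton]
    rcases dec y with rfl | hy
    · by_cases h1 : IsDoubleDescent π (ω y)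
      · have := k1 h1
        simp only [h1]
        unfold IsDoubleDescent IsDoubleAscent at *
        simp; omega
      by_cases h2 : IsDoubleAscent π (ω y)
      · simp [h1, h2, k2 h2]
      · rw [k3 h1 h2]; simp [h1, h2]
    · have := key y hy
      simp only [hy, false_and, not_false_eq_true, and_true, false_or]
      unfold IsDoubleDescent
      omega

theorem IsAlternating.psiSet_sets [DecidableEq P] (hω : Function.Injective ω)
    (h : IsAlternating ω r) (S : Finset P) {π : List ℤ} (hπ : π ∈ jordanHolder ω) :
    freeSet ω (psiSet ω S π) = freeSet ω π ∧ peakSet ω (psiSet ω S π) = peakSet ω π ∧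
      ddSet ω (psiSet ω S π) = symmDiff (S ∩ freeSet ω π) (ddSet ω π) ∧
      psiSet ω (S ∩ freeSet ω π) π = psiSet ω S π := by
  induction S using Finset.induction_on with
  | empty =>
    rw [Finset.empty_inter, psiSet_empty]
    exact ⟨rfl, rfl, (bot_symmDiff _).symm, rfl⟩
  | insert x S hx ih =>
    obtain ⟨h1, h2, h3, h4⟩ := ih
    have hS := psiSet_mem hω h S hπ
    obtain ⟨k1, k2, k3⟩ := h.psi_sets hω x hS
    rw [psiSet_insert hω h hx hπ, k1, k2, k3, h1, h2, h3]
    refine ⟨rfl, rfl, ?_, ?_⟩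
    · rw [← symmDiff_assoc]
      congr 1
      ext y; simp only [Finset.mem_insert, Finset.mem_symmDiff, Finset.mem_singleton,
        Finset.mem_inter]
      by_cases hy : y = x
      · simp [hy, hx]
      · simp [hy]
    · by_cases hf : x ∈ freeSet ω π
      · rw [Finset.insert_inter_of_mem hf, psiSet_insert hω h (by simp [hx]) hπ, h4]
      · rw [Finset.insert_inter_of_notMem hf, h4]
        rw [← h1] at hf
        simp only [freeSet, Finset.mem_filter, Finset.mem_univ, true_and, not_or] at hf
        exact (psi_of_not_double hf.1 hf.2).symm

/-! ### Orbits and the expansion for canonical labelings. -/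

theorem noDoubleDescent_iff (hω : Function.Injective ω) {π : List ℤ} (hπ : π ∈ jordanHolder ω) :
    NoDoubleDescent π ↔ ddSet ω π = ∅ := by
  have h2 := ((mem_jordanHolder hω).1 hπ).2.1
  simp only [NoDoubleDescent, ddSet, Finset.filter_eq_empty_iff, Finset.mem_univ, h2]
  grind

omit [PartialOrder P] in
theorem mem_orb {π σ : List ℤ} : σ ∈ orb ω π ↔ ∃ S, psiSet ω S π = σ := by simp [orb]

theorem orb_psiSet (hω : Function.Injective ω) (h : IsAlternating ω r) (S : Finset P)
    {π : List ℤ} (hπ : π ∈ jordanHolder ω) : orb ω (psiSet ω S π) = orb ω π := by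
  classical
  ext σ
  simp only [mem_orb]
  constructor
  · rintro ⟨T, rfl⟩
    exact ⟨_, (psiSet_psiSet hω h T S hπ).symm⟩
  · rintro ⟨T, rfl⟩
    refine ⟨symmDiff T S, ?_⟩
    rw [psiSet_psiSet hω h _ S hπ, symmDiff_symmDiff_cancel_right]

/-- Starting from no double descents, the double descents of `psiSet ω S τ` are the free elements of
`S`. If there are none, `S` acts trivially. -/
theorem psiSet_eq_of_noDoubleDescent (hω : Function.Injective ω) (h : IsAlternating ω r)
    {S : Finset P} {τ : List ℤ} (hτ : τ ∈ jordanHolder ω) (h1 : NoDoubleDescent τ)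
    (h2 : NoDoubleDescent (psiSet ω S τ)) : psiSet ω S τ = τ := by
  classical
  obtain ⟨-, -, h3, h4⟩ := h.psiSet_sets hω S hτ
  rw [noDoubleDescent_iff hω hτ] at h1
  rw [noDoubleDescent_iff hω (psiSet_mem hω h S hτ), h3, h1] at h2
  have : S ∩ freeSet ω τ = ∅ := by
    rw [← h2]; exact (symmDiff_bot _).symm
  rw [← h4, this, psiSet_empty]

/-- The element of the orbit of `π` without double descents. -/
def hat (ω : P → ℤ) (π : List ℤ) : List ℤ := psiSet ω (ddSet ω π) π

theorem noDoubleDescent_hat (hω : Function.Injective ω) (h : IsAlternating ω r)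
    {π : List ℤ} (hπ : π ∈ jordanHolder ω) : NoDoubleDescent (hat ω π) := by
  classical
  unfold hat
  rw [noDoubleDescent_iff hω (psiSet_mem hω h _ hπ), (h.psiSet_sets hω _ hπ).2.2.1]
  have : ddSet ω π ∩ freeSet ω π = ddSet ω π := by
    rw [Finset.inter_eq_left]
    intro x
    simp only [ddSet, freeSet, Finset.mem_filter, Finset.mem_univ, true_and]
    exact Or.inl
  rw [this]
  exact symmDiff_self _

theorem IsAlternating.two_mul_des_le [Nonempty P] (hω : Function.Injective ω)
    (h : IsAlternating ω r) {d : ℕ} (hd : (d : ℤ) = Fintype.card P - r - 1) {τ : List ℤ}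
    (hτ : τ ∈ jordanHolder ω) (h1 : NoDoubleDescent τ) :
    (freeSet ω τ).card + 2 * des τ = d := by
  obtain ⟨-, h2⟩ := h.des_counts hω hτ
  rw [noDoubleDescent_iff hω hτ] at h1
  rw [h1] at h2
  simp only [Finset.card_empty] at h2
  omega

/-- The orbit is a Boolean cube: a subset `T` of the free set is recovered as the set of double
descents, and it adds `T.card` descents. -/
theorem IsAlternating.sum_orb [Nonempty P] (hω : Function.Injective ω) (h : IsAlternating ω r)
    {d : ℕ} (hd : (d : ℤ) = Fintype.card P - r - 1) {τ : List ℤ} (hτ : τ ∈ jordanHolder ω)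
    (h1 : NoDoubleDescent τ) :
    ∑ σ ∈ orb ω τ, (X : ℤ[X]) ^ des σ = X ^ des τ * (1 + X) ^ (d - 2 * des τ) := by
  classical
  have hc := h.two_mul_des_le hω hd hτ h1
  have h1' := (noDoubleDescent_iff hω hτ).1 h1
  have hdd : ∀ T ⊆ freeSet ω τ, ddSet ω (psiSet ω T τ) = T := by
    intro T hT
    rw [(h.psiSet_sets hω T hτ).2.2.1, h1', Finset.inter_eq_left.2 hT]
    exact symmDiff_bot _
  have horb : orb ω τ = (freeSet ω τ).powerset.image fun T => psiSet ω T τ := by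
    ext σ
    rw [mem_orb, Finset.mem_image]
    constructor
    · rintro ⟨S, rfl⟩
      exact ⟨S ∩ freeSet ω τ, by simp, (h.psiSet_sets hω S hτ).2.2.2⟩
    · rintro ⟨T, -, rfl⟩
      exact ⟨T, rfl⟩
  have hdes : ∀ T ⊆ freeSet ω τ, des (psiSet ω T τ) = des τ + T.card := by
    intro T hT
    obtain ⟨-, h2⟩ := h.des_counts hω (psiSet_mem hω h T hτ)
    rw [hdd T hT, (h.psiSet_sets hω T hτ).1] at h2
    omega
  rw [horb, Finset.sum_image]
  · have e : d - 2 * des τ = (freeSet ω τ).card := by omega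
    rw [e, add_comm (1 : ℤ[X]), ← Finset.sum_pow_mul_eq_add_pow, Finset.mul_sum]
    refine Finset.sum_congr rfl fun T hT => ?_
    rw [hdes T (Finset.mem_powerset.1 hT), one_pow, mul_one, pow_add]
  · intro T hT T' hT' e
    rw [← hdd T (Finset.mem_powerset.1 hT), ← hdd T' (Finset.mem_powerset.1 hT')]
    exact congrArg _ e

theorem IsAlternating.eulerianPoly_eq [Nonempty P] (hω : Function.Injective ω)
    (h : IsAlternating ω r) {d : ℕ} (hd : (d : ℤ) = Fintype.card P - r - 1) :
    eulerianPoly ω = ∑ i ∈ Finset.range (d / 2 + 1),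
      C (((jordanHolder ω).filter fun π => NoDoubleDescent π ∧ des π = i).card : ℤ) *
        (X ^ i * (1 + X) ^ (d - 2 * i)) := by
  classical
  -- The orbits are the fibres of `hat`, indexed by the words without double descents.
  have s1 : eulerianPoly ω = ∑ τ ∈ (jordanHolder ω).filter fun π => NoDoubleDescent π,
      (X : ℤ[X]) ^ des τ * (1 + X) ^ (d - 2 * des τ) := by
    rw [eulerianPoly, ← Finset.sum_fiberwise_of_maps_to (g := hat ω)
      (t := (jordanHolder ω).filter fun π => NoDoubleDescent π)]
    · refine Finset.sum_congr rfl fun τ hτ => ?_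
      obtain ⟨hτ, h1⟩ := Finset.mem_filter.1 hτ
      rw [← h.sum_orb hω hd hτ h1]
      refine Finset.sum_congr ?_ fun _ _ => rfl
      ext π
      rw [Finset.mem_filter]
      constructor
      · rintro ⟨hπ, rfl⟩
        rw [hat, orb_psiSet hω h _ hπ, mem_orb]
        exact ⟨∅, psiSet_empty π⟩
      · intro hπ
        obtain ⟨S, rfl⟩ := mem_orb.1 hπ
        have hS := psiSet_mem hω h S hτ
        refine ⟨hS, ?_⟩
        have h2 := noDoubleDescent_hat hω h hS
        unfold hat at h2 ⊢
        rw [psiSet_psiSet hω h _ _ hτ] at h2 ⊢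
        exact psiSet_eq_of_noDoubleDescent hω h hτ h1 h2
    · intro π hπ
      exact Finset.mem_filter.2 ⟨psiSet_mem hω h _ hπ, noDoubleDescent_hat hω h hπ⟩
  rw [s1, ← Finset.sum_fiberwise_of_maps_to (g := des) (t := Finset.range (d / 2 + 1))]
  · refine Finset.sum_congr rfl fun i _ => ?_
    rw [Finset.filter_filter, Finset.sum_congr rfl (g := fun _ => X ^ i * (1 + X) ^ (d - 2 * i))]
    · rw [Finset.sum_const, nsmul_eq_mul]
      simp
    · intro τ hτ
      rw [(Finset.mem_filter.1 hτ).2.2]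
  · intro τ hτ
    obtain ⟨hτ, h1⟩ := Finset.mem_filter.1 hτ
    have := h.two_mul_des_le hω hd hτ h1
    rw [Finset.mem_range]; omega

end JordanHolder

/-! ### Dependence of the Eulerian polynomial on the labeling. -/

theorem des_map_congr {P : Type*} {ω ω' : P → ℤ} {l : List P}
    (h : ∀ a b, [a, b] <:+: l → (ω b < ω a ↔ ω' b < ω' a)) : des (l.map ω) = des (l.map ω') := by
  induction l with
  | nil => rfl
  | cons a l ih =>
    have ih := ih fun a b hab => h a b (hab.trans (List.suffix_cons _ _).isInfix)
    cases l with
    | nil => rfl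
    | cons b l =>
      have hab := h a b ⟨[], l, by simp⟩
      simp only [List.map_cons, des] at ih ⊢
      rw [ih]
      simp only [hab]

/-- Moving the labels of `M` from above all other labels to below all other labels. -/
theorem des_map_shift {P : Type*} {ω₁ ω₂ : P → ℤ} {M : P → Prop} [DecidablePred M]
    (h : ∀ a b, (M a ↔ M b) → (ω₁ a < ω₁ b ↔ ω₂ a < ω₂ b))
    (h' : ∀ a b, M a → ¬ M b → ω₁ b < ω₁ a ∧ ω₂ a < ω₂ b) (a : P) (l : List P) :
    des ((a :: l).map ω₂) + (if M a then 1 else 0) =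
      des ((a :: l).map ω₁) + (if M (l.getLastD a) then 1 else 0) := by
  induction l generalizing a with
  | nil => simp [des]
  | cons b l ih =>
    have ih := ih b
    rw [List.getLastD_cons]
    simp only [List.map_cons, des] at ih ⊢
    have h1 := h b a
    have h2 := h' a b
    have h3 := h' b a
    by_cases ha : M a <;> by_cases hb : M b
    · simp only [ha, hb, if_true, true_imp_iff] at ih h1 ⊢
      simp only [h1]
      omega
    · have h2 := h2 ha hb
      simp only [ha, hb, if_true, if_false] at ih ⊢
      rw [if_pos h2.1, if_neg (by omega)]
      omega
    · have h3 := h3 hb ha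
      simp only [ha, hb, if_true, if_false] at ih ⊢
      rw [if_pos h3.2, if_neg (by omega)]
      omega
    · simp only [ha, hb, if_false, true_imp_iff] at ih h1 ⊢
      simp only [h1]
      omega

section LinearExtensions

variable {P : Type*} [PartialOrder P] [Fintype P]

/-- The linear extensions of `P`, as lists. -/
noncomputable def linearExts (P : Type*) [PartialOrder P] [Fintype P] : Finset (List P) :=
  open Classical in
  {l ∈ (Finset.univ : Finset P).val.lists.toFinset | l.Pairwise fun a b => ¬ b < a}

theorem mem_linearExts {l : List P} :
    l ∈ linearExts P ↔ l.Nodup ∧ (∀ x, x ∈ l) ∧ l.Pairwise fun a b => ¬ b < a := by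
  classical
  have key : (l.Nodup ∧ ∀ a, a ∈ l) ↔ (Finset.univ : Finset P).val = (l : Multiset P) := by
    constructor
    · rintro ⟨h1, h2⟩
      rw [Multiset.Nodup.ext (Finset.nodup _) (Multiset.coe_nodup.2 h1)]
      intro a
      simp [h2]
    · intro h
      refine ⟨Multiset.coe_nodup.1 (h ▸ Finset.nodup _), fun a => ?_⟩
      rw [← Multiset.mem_coe, ← h]
      simp
  unfold linearExts
  rw [Finset.mem_filter, Multiset.mem_toFinset, Multiset.mem_lists_iff, ← and_assoc, key]
  rfl

theorem linearExts_nonempty : (linearExts P).Nonempty := by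
  classical
  let _ : Fintype (LinearExtension P) := inferInstanceAs (Fintype P)
  obtain ⟨l, hn, hm, h⟩ : ∃ l : List (LinearExtension P),
      l.Nodup ∧ (∀ x, x ∈ l) ∧ l.Pairwise (· ≤ ·) :=
    ⟨Finset.univ.sort (· ≤ ·), Finset.sort_nodup _ _, by simp, Finset.pairwise_sort _ _⟩
  refine ⟨l, mem_linearExts.2 ⟨hn, hm, ?_⟩⟩
  refine (h.and hn).imp ?_
  intro a b hab hlt
  have : toLinearExtension (α := P) b ≤ toLinearExtension (α := P) a :=
    toLinearExtension.monotone (le_of_lt hlt)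
  exact hab.2 (le_antisymm hab.1 this)

/-- The index set no longer involves the labels, so different labelings can be compared term by
term. -/
theorem eulerianPoly_eq_sum {ω : P → ℤ} (hω : Function.Injective ω) :
    eulerianPoly ω = ∑ l ∈ linearExts P, X ^ des (l.map ω) := by
  symm
  refine Finset.sum_nbij (fun l => l.map ω) ?_ ?_ ?_ fun _ _ => rfl
  · intro l hl
    obtain ⟨h1, h2, h3⟩ := mem_linearExts.1 hl
    refine (mem_jordanHolder hω).2 ⟨h1.map hω, ?_, ?_⟩
    · intro a; simp [h2]
    · rw [List.pairwise_map]
      refine h3.imp ?_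
      intro a b hab u v hu hv
      rwa [hω hu, hω hv]
  · exact fun l _ l' _ h => List.map_injective_iff.2 hω h
  · intro π hπ
    obtain ⟨h1, h2, h3⟩ := (mem_jordanHolder hω).1 hπ
    obtain ⟨l, rfl⟩ : π ∈ Set.range (List.map ω) := by
      rw [Set.range_list_map]
      exact fun a ha => (h2 a).1 ha
    refine ⟨l, mem_linearExts.2 ⟨h1.of_map, fun x => ?_, ?_⟩, rfl⟩
    · have := (h2 (ω x)).2 ⟨x, rfl⟩
      rwa [List.mem_map_of_injective hω] at this
    · rw [List.pairwise_map] at h3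
      exact h3.imp fun hab => hab _ _ rfl rfl

theorem eulerianPoly_ne_zero {ω : P → ℤ} (hω : Function.Injective ω) : eulerianPoly ω ≠ 0 := by
  intro h
  have := congrArg (eval 1) h
  rw [eulerianPoly_eq_sum hω, eval_finsetSum] at this
  simp only [eval_pow, eval_X, one_pow, Finset.sum_const, eval_zero, nsmul_eq_mul, mul_one,
    Nat.cast_eq_zero, Finset.card_eq_zero] at this
  exact linearExts_nonempty.ne_empty this

theorem jordanHolder_nonempty {ω : P → ℤ} (hω : Function.Injective ω) :
    (jordanHolder ω).Nonempty := by
  rw [Finset.nonempty_iff_ne_empty]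
  intro h
  exact eulerianPoly_ne_zero hω (by rw [eulerianPoly, h, Finset.sum_empty])

-- Two labels with no label between them compare alike with every other label, so exchanging them
-- can affect only the pair itself.
omit [PartialOrder P] [Fintype P] in
theorem swap_lt_swap_iff [DecidableEq P] {ω : P → ℤ} (hω : Function.Injective ω) {x y : P}
    (hxy : ω x < ω y) (hb : ∀ z, ¬ (ω x < ω z ∧ ω z < ω y)) {u v : P}
    (h₁ : ¬ (u = x ∧ v = y)) (h₂ : ¬ (u = y ∧ v = x)) :
    ω (Equiv.swap x y u) < ω (Equiv.swap x y v) ↔ ω u < ω v := by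
  have hne : ∀ a b, a ≠ b → ω a ≠ ω b := fun a b h e => h (hω e)
  have hxy' : x ≠ y := by rintro rfl; exact lt_irrefl _ hxy
  have hu := hb u
  have hv := hb v
  have hux := hne u x
  have huy := hne u y
  have hvx := hne v x
  have hvy := hne v y
  by_cases h1 : u = x
  · subst h1
    by_cases h2 : v = u
    · subst h2; simp
    · have h3 : v ≠ y := fun e => h₁ ⟨rfl, e⟩
      rw [Equiv.swap_apply_left, Equiv.swap_apply_of_ne_of_ne h2 h3]
      have := hvx h2; have := hvy h3
      omega
  by_cases h2 : u = y
  · subst h2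
    by_cases h3 : v = u
    · subst h3; simp
    · have h4 : v ≠ x := fun e => h₂ ⟨rfl, e⟩
      rw [Equiv.swap_apply_right, Equiv.swap_apply_of_ne_of_ne h4 h3]
      have := hvx h4; have := hvy h3
      omega
  rw [Equiv.swap_apply_of_ne_of_ne h1 h2]
  have := hux h1; have := huy h2
  by_cases h3 : v = x
  · subst h3
    rw [Equiv.swap_apply_left]; omega
  by_cases h4 : v = y
  · subst h4
    rw [Equiv.swap_apply_right]; omega
  rw [Equiv.swap_apply_of_ne_of_ne h3 h4]

/-- If `x < y` is not a cover, an intermediate element would separate `x` from `y` in the list. So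
these neighbours are incomparable and may be exchanged. -/
theorem map_swap_mem_linearExts [DecidableEq P] {x y : P} (hxy : ¬ x ⋖ y) {l : List P}
    (hl : l ∈ linearExts P) (h : [x, y] <:+: l) :
    l.map (Equiv.swap x y) ∈ linearExts P ∧ [y, x] <:+: l.map (Equiv.swap x y) := by
  obtain ⟨h1, h2, h3⟩ := mem_linearExts.1 hl
  obtain ⟨U, V, rfl⟩ := h
  have hlt : ¬ x < y := by
    intro hlt
    refine hxy ⟨hlt, fun z hxz hzy => ?_⟩
    have hz := h2 z
    have hzx := hxz.ne
    have hzy' := hzy.ne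
    simp only [List.pairwise_append, List.pairwise_cons, List.mem_append, List.mem_cons] at h3 hz
    grind
  have id' : ∀ W : List P, x ∉ W → y ∉ W → W.map (Equiv.swap x y) = W := by
    intro W hx hy
    conv_rhs => rw [← List.map_id W]
    refine List.map_congr_left fun a ha => ?_
    rw [Equiv.swap_apply_of_ne_of_ne]
    · rfl
    · rintro rfl; exact hx ha
    · rintro rfl; exact hy ha
  have e : (U ++ [x, y] ++ V).map (Equiv.swap x y) = U ++ [y, x] ++ V := by
    rw [List.map_append, List.map_append, id' U (by grind) (by grind), id' V (by grind) (by grind)]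
    simp
  rw [e]
  have hperm : (U ++ [y, x] ++ V).Perm (U ++ [x, y] ++ V) :=
    ((List.Perm.swap x y []).append_left U).append_right V
  refine ⟨mem_linearExts.2 ⟨hperm.nodup_iff.2 h1, fun z => hperm.mem_iff.2 (h2 z), ?_⟩, U, V, rfl⟩
  clear e id' hperm h1 h2 hl hxy
  simp only [List.pairwise_append, List.pairwise_cons, List.mem_append, List.mem_cons,
    List.not_mem_nil, or_false] at h3 ⊢
  grind

/-- Where `x` and `y` are adjacent in a linear extension, exchange their positions; elsewhere keep
the list, since no adjacent pair notices the exchange of labels. -/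
theorem eulerianPoly_swap [DecidableEq P] {ω : P → ℤ} (hω : Function.Injective ω) {x y : P}
    (hxy : ω x < ω y) (hb : ∀ z, ¬ (ω x < ω z ∧ ω z < ω y)) (h₁ : ¬ x ⋖ y) (h₂ : ¬ y ⋖ x) :
    eulerianPoly (ω ∘ Equiv.swap x y) = eulerianPoly ω := by
  classical
  rw [eulerianPoly_eq_sum hω, eulerianPoly_eq_sum (hω.comp (Equiv.injective _))]
  let φ : List P → List P := fun l =>
    if [x, y] <:+: l ∨ [y, x] <:+: l then l.map (Equiv.swap x y) else l
  have hφ : ∀ l ∈ linearExts P, ([x, y] <:+: l ∨ [y, x] <:+: l) →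
      l.map (Equiv.swap x y) ∈ linearExts P ∧ ([x, y] <:+: l.map (Equiv.swap x y) ∨
        [y, x] <:+: l.map (Equiv.swap x y)) := by
    rintro l hl (h | h)
    · obtain ⟨h3, h4⟩ := map_swap_mem_linearExts h₁ hl h
      exact ⟨h3, .inr h4⟩
    · obtain ⟨h3, h4⟩ := map_swap_mem_linearExts h₂ hl h
      rw [Equiv.swap_comm]
      exact ⟨h3, .inl h4⟩
  have hmem : ∀ l ∈ linearExts P, φ l ∈ linearExts P := by
    intro l hl
    by_cases h : [x, y] <:+: l ∨ [y, x] <:+: l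
    · simp only [φ, if_pos h]; exact (hφ l hl h).1
    · simp only [φ, if_neg h]; exact hl
  have hinv : ∀ l ∈ linearExts P, φ (φ l) = l := by
    intro l hl
    by_cases h : [x, y] <:+: l ∨ [y, x] <:+: l
    · simp only [φ, if_pos h, if_pos (hφ l hl h).2]
      simp [Function.comp_def]
    · simp only [φ, if_neg h]
  refine Finset.sum_nbij' φ φ hmem hmem hinv hinv ?_
  intro l hl
  by_cases h : [x, y] <:+: l ∨ [y, x] <:+: l
  · simp only [φ, if_pos h, List.map_map]
  · simp only [φ, if_neg h]
    congr 1
    refine des_map_congr fun a b hab => ?_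
    refine swap_lt_swap_iff hω hxy hb ?_ ?_
    · rintro ⟨rfl, rfl⟩; exact h (.inr hab)
    · rintro ⟨rfl, rfl⟩; exact h (.inl hab)

/-- The Eulerian polynomial depends only on the signs of the covering relations. -/
theorem eulerianPoly_congr {ω ω' : P → ℤ} (hω : Function.Injective ω)
    (hω' : Function.Injective ω') (h : ∀ x y, x ⋖ y → (ω x < ω y ↔ ω' x < ω' y)) :
    eulerianPoly ω = eulerianPoly ω' := by
  classical
  let inv : (P → ℤ) → Finset (P × P) := fun ω => {p | ω p.1 < ω p.2 ∧ ω' p.2 < ω' p.1}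
  have mem_inv : ∀ ω u v, (u, v) ∈ inv ω ↔ ω u < ω v ∧ ω' v < ω' u := by
    intro ω u v; simp [inv]
  induction hn : (inv ω).card using Nat.strong_induction_on generalizing ω with
  | _ n ih =>
  rcases (inv ω).eq_empty_or_nonempty with h0 | hne
  · rw [eulerianPoly_eq_sum hω, eulerianPoly_eq_sum hω']
    refine Finset.sum_congr rfl fun l hl => ?_
    congr 1
    have hnd := (mem_linearExts.1 hl).1
    refine des_map_congr fun a b hab => ?_
    have hab' : a ≠ b := by
      have := hnd.sublist hab.sublist
      simpa using this
    have n1 : ω a ≠ ω b := fun e => hab' (hω e)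
    have n2 : ω' a ≠ ω' b := fun e => hab' (hω' e)
    have m1 := mem_inv ω a b
    have m2 := mem_inv ω b a
    simp only [h0, Finset.notMem_empty, false_iff] at m1 m2
    omega
  -- An inversion between the two labelings with least label gap has no label in between, since such
  -- a label would form a smaller inversion with `x` or `y`. Exchanging the two labels removes this
  -- inversion and creates none, as in bubble sort.
  · obtain ⟨⟨x, y⟩, hp, hmin⟩ := Finset.exists_min_image (inv ω) (fun p => ω p.2 - ω p.1) hne
    obtain ⟨hxy, hxy'⟩ := (mem_inv ω x y).1 hp
    have hb : ∀ z, ¬ (ω x < ω z ∧ ω z < ω y) := by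
      rintro z ⟨hxz, hzy⟩
      rcases lt_or_ge (ω' z) (ω' x) with hz | hz
      · have := hmin (x, z) ((mem_inv ω x z).2 ⟨hxz, hz⟩)
        simp only at this; omega
      · have := hmin (z, y) ((mem_inv ω z y).2 ⟨hzy, by omega⟩)
        simp only at this; omega
    have h₁ : ¬ x ⋖ y := fun hc => by have := h x y hc; omega
    have h₂ : ¬ y ⋖ x := fun hc => by have := h y x hc; omega
    rw [← eulerianPoly_swap hω hxy hb h₁ h₂]
    have hω'' := hω.comp (Equiv.swap x y).injective
    refine ih (inv (ω ∘ Equiv.swap x y)).card ?_ hω'' ?_ rfl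
    · rw [← hn]
      refine Finset.card_lt_card (Finset.ssubset_iff_of_subset ?_ |>.2 ⟨(x, y), hp, ?_⟩)
      · rintro ⟨u, v⟩ huv
        rw [mem_inv] at huv ⊢
        refine ⟨?_, huv.2⟩
        by_cases e1 : u = x ∧ v = y
        · obtain ⟨rfl, rfl⟩ := e1; exact hxy
        by_cases e2 : u = y ∧ v = x
        · obtain ⟨rfl, rfl⟩ := e2; omega
        exact (swap_lt_swap_iff hω hxy hb e1 e2).1 huv.1
      · rw [mem_inv]
        simp only [Function.comp_apply, Equiv.swap_apply_left, Equiv.swap_apply_right]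
        omega
    · intro u v huv
      rw [← h u v huv]
      refine swap_lt_swap_iff hω hxy hb ?_ ?_
      · rintro ⟨rfl, rfl⟩; exact h₁ huv
      · rintro ⟨rfl, rfl⟩; exact h₂ huv

end LinearExtensions

/-! ### Expansions in t^i (1+t)^(d-2i) and multiplication by t. -/

/-- `W` has a nonnegative expansion in the polynomials `t^i (1 + t)^(d - 2i)`. -/
def HasGammaExpansion (W : ℤ[X]) (d : ℕ) : Prop :=
  ∃ a : ℕ → ℕ, W = ∑ i ∈ Finset.range (d / 2 + 1), C (a i : ℤ) * (X ^ i * (1 + X) ^ (d - 2 * i))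

theorem HasGammaExpansion.X_mul {W : ℤ[X]} {d : ℕ} (h : HasGammaExpansion W d) :
    HasGammaExpansion (X * W) (d + 2) := by
  obtain ⟨a, rfl⟩ := h
  refine ⟨fun i => if i = 0 then 0 else a (i - 1), ?_⟩
  have e : (d + 2) / 2 + 1 = (d / 2 + 1) + 1 := by omega
  rw [e, Finset.sum_range_succ' _ (d / 2 + 1), Finset.mul_sum]
  simp only [Nat.add_eq_zero_iff, one_ne_zero, and_false, if_false, if_true, Nat.cast_zero, C_0,
    zero_mul, add_zero, Nat.add_sub_cancel]
  refine Finset.sum_congr rfl fun i _ => ?_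
  have e : d + 2 - 2 * (i + 1) = d - 2 * i := by omega
  rw [e]
  ring

/-- Evaluation at 0 kills the coefficient `a 0`, and the remaining terms are divisible by `X`; `W ≠
0` forces at least one such term, hence `2 ≤ d`. -/
theorem HasGammaExpansion.of_X_mul {W : ℤ[X]} {d : ℕ} (h : HasGammaExpansion (X * W) d)
    (hW : W ≠ 0) : 2 ≤ d ∧ HasGammaExpansion W (d - 2) := by
  obtain ⟨a, ha⟩ := h
  have h0 : a 0 = 0 := by
    have := congrArg (eval 0) ha
    rw [Finset.sum_range_succ', eval_add, eval_finsetSum] at this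
    simpa using this.symm
  rw [Finset.sum_range_succ', h0] at ha
  simp only [Nat.cast_zero, C_0, zero_mul, add_zero] at ha
  have h1 : W = ∑ i ∈ Finset.range (d / 2),
      C (a (i + 1) : ℤ) * (X ^ i * (1 + X) ^ (d - 2 - 2 * i)) := by
    refine mul_left_cancel₀ (X_ne_zero (R := ℤ)) ?_
    rw [ha, Finset.mul_sum]
    refine Finset.sum_congr rfl fun i _ => ?_
    have e : d - 2 * (i + 1) = d - 2 - 2 * i := by omega
    rw [e]
    ring
  have h2 : 2 ≤ d := by
    by_contra! hlt
    have : d / 2 = 0 := by omega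
    rw [this, Finset.range_zero, Finset.sum_empty] at h1
    exact hW h1
  refine ⟨h2, fun i => a (i + 1), ?_⟩
  have e : (d - 2) / 2 + 1 = d / 2 := by omega
  rw [e]
  exact h1

/-! ### Reduction to ranks 0 and 1. -/

section Relabel

variable {P : Type*} [PartialOrder P] [Fintype P]

/-- A labeling ordering the elements by the values of `κ`. -/
noncomputable def labelBy (κ : P → ℤ) (x : P) : ℤ :=
  Fintype.card P * κ x + (Fintype.equivFin P x : ℕ)

omit [PartialOrder P] in
theorem labelBy_lt {κ : P → ℤ} {x y : P} (h : κ x < κ y) : labelBy κ x < labelBy κ y := by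
  unfold labelBy
  have h1 := (Fintype.equivFin P x).isLt
  have h2 : (Fintype.card P : ℤ) * (κ x + 1) ≤ Fintype.card P * κ y :=
    mul_le_mul_of_nonneg_left h (by positivity)
  rw [mul_add, mul_one] at h2
  omega

omit [PartialOrder P] in
theorem labelBy_lt_iff_of_eq {κ κ' : P → ℤ} {x y : P} (h : κ x = κ y) (h' : κ' x = κ' y) :
    labelBy κ x < labelBy κ y ↔ labelBy κ' x < labelBy κ' y := by
  unfold labelBy
  rw [h, h']
  omega

omit [PartialOrder P] in
theorem labelBy_injective (κ : P → ℤ) : Function.Injective (labelBy κ) := by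
  intro x y h
  have hκ : κ x = κ y := by
    rcases lt_trichotomy (κ x) (κ y) with hlt | heq | hgt
    · exact absurd h (labelBy_lt hlt).ne
    · exact heq
    · exact absurd h (labelBy_lt hgt).ne'
  unfold labelBy at h
  rw [hκ] at h
  exact (Fintype.equivFin P).injective (Fin.ext (by omega))

/-- Moving the block `M` from above to below all other labels changes the descent number by [last
letter in `M`] - [first letter in `M`]. The first letter is minimal, hence outside `M`; the last is
maximal. -/
theorem eulerianPoly_shift [Nonempty P] {κ₁ κ₂ : P → ℤ} {M : P → Prop}
    (hM : ∀ x, ¬ M x → κ₁ x = κ₂ x) (h₁ : ∀ x y, M x → M y → κ₁ x = κ₁ y)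
    (h₂ : ∀ x y, M x → M y → κ₂ x = κ₂ y)
    (h : ∀ x y, M x → ¬ M y → κ₁ y < κ₁ x ∧ κ₂ x < κ₂ y) (hmin : ∀ x, IsMin x → ¬ M x) :
    ((∀ x, IsMax x → ¬ M x) → eulerianPoly (labelBy κ₂) = eulerianPoly (labelBy κ₁)) ∧
    ((∀ x, IsMax x → M x) → eulerianPoly (labelBy κ₂) = X * eulerianPoly (labelBy κ₁)) := by
  classical
  rw [eulerianPoly_eq_sum (labelBy_injective κ₁), eulerianPoly_eq_sum (labelBy_injective κ₂)]
  have key : ∀ l ∈ linearExts P, ∃ x, IsMax x ∧ des (l.map (labelBy κ₂)) =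
      des (l.map (labelBy κ₁)) + if M x then 1 else 0 := by
    intro l hl
    obtain ⟨-, hmem, hp⟩ := mem_linearExts.1 hl
    have hne : l ≠ [] := List.ne_nil_of_mem (hmem (Classical.arbitrary P))
    have hlast : IsMax (l.getLast hne) := by
      rw [← List.dropLast_append_getLast hne, List.pairwise_append] at hp
      refine isMax_iff_forall_not_lt.2 fun v hv => ?_
      have := hmem v
      rw [← List.dropLast_append_getLast hne, List.mem_append, List.mem_singleton] at this
      rcases this with hvm | rfl
      · exact hp.2.2 v hvm _ (by simp) hv
      · exact lt_irrefl _ hv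
    refine ⟨l.getLast hne, hlast, ?_⟩
    have hcons := List.exists_cons_of_ne_nil hne
    obtain ⟨a, l, rfl⟩ := hcons
    have ha : IsMin a := by
      refine isMin_iff_forall_not_lt.2 fun v hv => ?_
      have := hmem v
      rw [List.mem_cons] at this
      rcases this with rfl | hvm
      · exact lt_irrefl _ hv
      · exact (List.pairwise_cons.1 hp).1 v hvm hv
    have := des_map_shift (ω₁ := labelBy κ₁) (ω₂ := labelBy κ₂) (M := M) (fun x y hxy => by
        by_cases hx : M x
        · exact labelBy_lt_iff_of_eq (h₁ x y hx (hxy.1 hx)) (h₂ x y hx (hxy.1 hx))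
        · have hy : ¬ M y := fun hy => hx (hxy.2 hy)
          unfold labelBy
          rw [hM x hx, hM y hy])
      (fun x y hx hy => ⟨labelBy_lt (h x y hx hy).1, labelBy_lt (h x y hx hy).2⟩) a l
    rw [if_neg (hmin a ha)] at this
    rw [List.getLast_eq_getLastD]
    exact this
  constructor
  · intro hmax
    refine Finset.sum_congr rfl fun l hl => ?_
    obtain ⟨x, hx, e⟩ := key l hl
    rw [e, if_neg (hmax x hx), add_zero]
  · intro hmax
    rw [Finset.mul_sum]
    refine Finset.sum_congr rfl fun l hl => ?_
    obtain ⟨x, hx, e⟩ := key l hl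
    rw [e, if_pos (hmax x hx), pow_succ']

omit [Fintype P] in
theorem IsRankFunction.lt_iff {ω ρ : P → ℤ} {r : ℤ} (h : IsRankFunction ω ρ r) {x y : P}
    (hxy : x ⋖ y) : ω x < ω y ↔ ρ x < ρ y := by
  have := h.covBy x y hxy
  split_ifs at this <;> omega

theorem IsRankFunction.eulerianPoly_eq {ω ρ : P → ℤ} {r : ℤ} (h : IsRankFunction ω ρ r)
    (hω : Function.Injective ω) {κ : P → ℤ}
    (hκ : ∀ x y, x ⋖ y → (ρ x < ρ y → κ x < κ y) ∧ (ρ y < ρ x → κ y < κ x)) :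
    eulerianPoly ω = eulerianPoly (labelBy κ) := by
  refine eulerianPoly_congr hω (labelBy_injective κ) fun x y hxy => ?_
  rw [h.lt_iff hxy]
  obtain ⟨h1, h2⟩ := hκ x y hxy
  rcases lt_trichotomy (ρ x) (ρ y) with hlt | heq | hgt
  · exact iff_of_true hlt (labelBy_lt (h1 hlt))
  · have := h.covBy x y hxy
    split_ifs at this <;> omega
  · exact iff_of_false hgt.not_gt (labelBy_lt (h2 hgt)).not_gt

/-- Lowering by two the rank of all the elements of the highest rank `m`. -/
theorem IsRankFunction.lower_top {ω ρ : P → ℤ} {r m : ℤ} (h : IsRankFunction ω ρ r)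
    (hm : ∀ x, ρ x ≤ m) (hm2 : 2 ≤ m) :
    IsRankFunction (labelBy fun x => if ρ x = m then m - 2 else ρ x)
      (fun x => if ρ x = m then m - 2 else ρ x) (if r = m then m - 2 else r) := by
  refine ⟨fun x hx => ?_, fun x hx => ?_, fun x y hxy => ?_⟩
  · simp only [h.isMin x hx]
    rw [if_neg (by omega)]
  · simp only [h.isMax x hx]
  -- Every cover at an element of rank `m` joins it to one of rank `m - 1`, so the covers meeting
  -- the top level are exactly those that change sign.
  · have h1 := h.covBy x y hxy
    have hx := hm x
    have hy := hm y
    by_cases hlt : (if ρ x = m then m - 2 else ρ x) < (if ρ y = m then m - 2 else ρ y)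
    · rw [if_pos (labelBy_lt hlt)]
      split_ifs at h1 hlt ⊢ <;> omega
    · have hgt : (if ρ y = m then m - 2 else ρ y) < (if ρ x = m then m - 2 else ρ x) := by
        split_ifs at h1 hlt ⊢ <;> omega
      rw [if_neg (labelBy_lt (κ := fun x => if ρ x = m then m - 2 else ρ x) hgt).not_gt]
      split_ifs at h1 hgt ⊢ <;> omega

/-- Raising by two the rank of all the elements of the lowest rank `m`. -/
theorem IsRankFunction.raise_bottom {ω ρ : P → ℤ} {r m : ℤ} (h : IsRankFunction ω ρ r)
    (hm : ∀ x, m ≤ ρ x) (hm2 : m ≤ -1) :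
    IsRankFunction (labelBy fun x => if ρ x = m then m + 2 else ρ x)
      (fun x => if ρ x = m then m + 2 else ρ x) (if r = m then m + 2 else r) := by
  refine ⟨fun x hx => ?_, fun x hx => ?_, fun x y hxy => ?_⟩
  · simp only [h.isMin x hx]
    rw [if_neg (by omega)]
  · simp only [h.isMax x hx]
  · have h1 := h.covBy x y hxy
    have hx := hm x
    have hy := hm y
    by_cases hlt : (if ρ x = m then m + 2 else ρ x) < (if ρ y = m then m + 2 else ρ y)
    · rw [if_pos (labelBy_lt hlt)]
      split_ifs at h1 hlt ⊢ <;> omega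
    · have hgt : (if ρ y = m then m + 2 else ρ y) < (if ρ x = m then m + 2 else ρ x) := by
        split_ifs at h1 hlt ⊢ <;> omega
      rw [if_neg (labelBy_lt (κ := fun x => if ρ x = m then m + 2 else ρ x) hgt).not_gt]
      split_ifs at h1 hgt ⊢ <;> omega

omit [PartialOrder P] in
theorem exists_bound (ρ : P → ℤ) : ∃ c, ∀ x, -c < ρ x ∧ ρ x < c := by
  refine ⟨1 + ∑ x, |ρ x|, fun x => ?_⟩
  have := Finset.single_le_sum (f := fun x => |ρ x|) (fun _ _ => abs_nonneg _) (Finset.mem_univ x)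
  have := abs_le.1 this
  constructor <;> omega

theorem IsRankFunction.eulerianPoly_lower_top [Nonempty P] {ω ρ : P → ℤ} {r m : ℤ}
    (h : IsRankFunction ω ρ r) (hω : Function.Injective ω) (hm : ∀ x, ρ x ≤ m) (hm2 : 2 ≤ m) :
    eulerianPoly (labelBy fun x => if ρ x = m then m - 2 else ρ x) =
      (if r = m then X else 1) * eulerianPoly ω := by
  obtain ⟨c, hc⟩ := exists_bound ρ
  have e1 := h.eulerianPoly_eq hω (κ := ρ) fun x y _ => ⟨id, id⟩
  -- Only covers matter, and the neighbours of the top level have rank `m - 1`; so the lowered level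
  -- may as well get the value `-c`, below everything.
  have e2 := (h.lower_top hm hm2).eulerianPoly_eq (labelBy_injective _)
    (κ := fun x => if ρ x = m then -c else ρ x) fun x y hxy => by
      have h1 := h.covBy x y hxy
      have := hc x; have := hc y; have := hm x; have := hm y
      constructor <;> intro h2 <;> split_ifs at h1 h2 ⊢ <;> omega
  obtain ⟨s1, s2⟩ := eulerianPoly_shift (κ₁ := ρ) (κ₂ := fun x => if ρ x = m then -c else ρ x)
    (M := fun x => ρ x = m) (fun x hx => by simp [hx]) (fun x y hx hy => by omega)
    (fun x y hx hy => by simp [hx, hy])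
    (fun x y hx hy => by
      have := hc y; have := hm y
      simp only [hx, hy, if_true, if_false]; omega)
    (fun x hx => by have := h.isMin x hx; omega)
  rw [e2, e1]
  split_ifs with hr
  · exact s2 fun x hx => by rw [h.isMax x hx, hr]
  · rw [one_mul]
    exact s1 fun x hx => by rw [h.isMax x hx]; exact hr

/-- Dual to lowering the top level. The block now lies below everything in the original labeling, so
the factor `X` falls on the side of the modified one. -/
theorem IsRankFunction.eulerianPoly_raise_bottom [Nonempty P] {ω ρ : P → ℤ} {r m : ℤ}
    (h : IsRankFunction ω ρ r) (hω : Function.Injective ω) (hm : ∀ x, m ≤ ρ x) (hm2 : m ≤ -1) :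
    eulerianPoly ω = (if r = m then X else 1) *
      eulerianPoly (labelBy fun x => if ρ x = m then m + 2 else ρ x) := by
  obtain ⟨c, hc⟩ := exists_bound ρ
  have e1 := h.eulerianPoly_eq hω (κ := ρ) fun x y _ => ⟨id, id⟩
  have e2 := (h.raise_bottom hm hm2).eulerianPoly_eq (labelBy_injective _)
    (κ := fun x => if ρ x = m then c else ρ x) fun x y hxy => by
      have h1 := h.covBy x y hxy
      have := hc x; have := hc y; have := hm x; have := hm y
      constructor <;> intro h2 <;> split_ifs at h1 h2 ⊢ <;> omega
  obtain ⟨s1, s2⟩ := eulerianPoly_shift (κ₂ := ρ) (κ₁ := fun x => if ρ x = m then c else ρ x)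
    (M := fun x => ρ x = m) (fun x hx => by simp [hx])
    (fun x y hx hy => by simp [hx, hy]) (fun x y hx hy => by omega)
    (fun x y hx hy => by
      have := hc y; have := hm y
      simp only [hx, hy, if_true, if_false]; omega)
    (fun x hx => by have := h.isMin x hx; omega)
  rw [e2, e1]
  split_ifs with hr
  · exact s2 fun x hx => by rw [h.isMax x hx, hr]
  · rw [one_mul]
    exact s1 fun x hx => by rw [h.isMax x hx]; exact hr

theorem IsAlternating.exists_natCast_eq [Nonempty P] {ω : P → ℤ} {r : ℤ}
    (hω : Function.Injective ω) (h : IsAlternating ω r) :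
    ∃ d : ℕ, (d : ℤ) = Fintype.card P - r - 1 := by
  obtain ⟨π, hπ⟩ := jordanHolder_nonempty hω
  have hτ : hat ω π ∈ jordanHolder ω := psiSet_mem hω h _ hπ
  have h1 := noDoubleDescent_hat hω h hπ
  obtain ⟨-, h2⟩ := h.des_counts hω hτ
  rw [noDoubleDescent_iff hω hτ] at h1
  rw [h1, Finset.card_empty] at h2
  exact ⟨(freeSet ω (hat ω π)).card + 2 * des (hat ω π), by push_cast; omega⟩

theorem IsRankFunction.hasGammaExpansion_of_mem_zero_one [Nonempty P] {ω ρ : P → ℤ} {r : ℤ}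
    (h : IsRankFunction ω ρ r) (hω : Function.Injective ω) (h01 : ∀ x, ρ x = 0 ∨ ρ x = 1) :
    ∃ d : ℕ, (d : ℤ) = Fintype.card P - r - 1 ∧ HasGammaExpansion (eulerianPoly ω) d := by
  let e : P → ℤ := fun x => (Fintype.equivFin P x : ℕ)
  have he : Function.Injective e := fun x y hxy =>
    (Fintype.equivFin P).injective (Fin.ext (Nat.cast_injective (R := ℤ) hxy))
  have he0 : ∀ x, 0 ≤ e x := fun x => Int.natCast_nonneg _
  -- A canonical labeling with the same signs of covers as `ω`.
  let ω' : P → ℤ := fun x => if ρ x = 0 then -(e x + 1) else e x + 1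
  have hneg : ∀ x, ρ x = 0 → ω' x = -(e x + 1) := fun x hx => if_pos hx
  have hpos : ∀ x, ρ x = 1 → ω' x = e x + 1 := fun x hx => if_neg (by omega)
  have hω' : Function.Injective ω' := by
    intro x y hxy
    apply he
    have := he0 x; have := he0 y
    rcases h01 x with hx | hx <;> rcases h01 y with hy | hy
    · rw [hneg x hx, hneg y hy] at hxy; omega
    · rw [hneg x hx, hpos y hy] at hxy; omega
    · rw [hpos x hx, hneg y hy] at hxy; omega
    · rw [hpos x hx, hpos y hy] at hxy; omega
  have hlt : ∀ x y, x ⋖ y → (ω x < ω y ↔ ω' x < ω' y) := by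
    intro x y hxy
    have h1 := h.covBy x y hxy
    rw [h.lt_iff hxy]
    have := he0 x; have := he0 y
    rcases h01 x with hx | hx <;> rcases h01 y with hy | hy
    · split_ifs at h1 <;> omega
    · rw [hneg x hx, hpos y hy]; omega
    · rw [hpos x hx, hneg y hy]; omega
    · split_ifs at h1 <;> omega
  have h' : IsRankFunction ω' ρ r := by
    refine ⟨h.isMin, h.isMax, fun x y hxy => ?_⟩
    have h1 := h.covBy x y hxy
    simp only [hlt x y hxy] at h1
    exact h1
  have halt : IsAlternating ω' r := h'.isAlternating fun x => by
    have := he0 x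
    rcases h01 x with hx | hx
    · rw [hneg x hx]; omega
    · rw [hpos x hx]; omega
  obtain ⟨d, hd⟩ := halt.exists_natCast_eq hω'
  refine ⟨d, hd, ?_⟩
  rw [eulerianPoly_congr hω hω' hlt]
  exact ⟨_, halt.eulerianPoly_eq hω' hd⟩

theorem IsRankFunction.hasGammaExpansion [Nonempty P] {ω ρ : P → ℤ} {r : ℤ}
    (h : IsRankFunction ω ρ r) (hω : Function.Injective ω) :
    ∃ d : ℕ, (d : ℤ) = Fintype.card P - r - 1 ∧ HasGammaExpansion (eulerianPoly ω) d := by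
  -- Each summand measures the distance of a rank from 1/2, so it is least at ranks 0 and 1.
  -- Lowering a rank ≥ 2 or raising a rank ≤ -1 by two decreases it strictly.
  induction hn : ∑ x, (2 * ρ x - 1).natAbs using Nat.strong_induction_on generalizing ω ρ r with
  | _ n ih =>
  obtain ⟨t, -, ht⟩ := Finset.exists_max_image Finset.univ ρ Finset.univ_nonempty
  obtain ⟨b, -, hb⟩ := Finset.exists_min_image Finset.univ ρ Finset.univ_nonempty
  have ht : ∀ x, ρ x ≤ ρ t := fun x => ht x (Finset.mem_univ x)
  have hb : ∀ x, ρ b ≤ ρ x := fun x => hb x (Finset.mem_univ x)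
  by_cases ht2 : 2 ≤ ρ t
  · obtain ⟨d, hd, hg⟩ := ih _ (by
      rw [← hn]
      refine Finset.sum_lt_sum (fun x _ => ?_) ⟨t, Finset.mem_univ t, ?_⟩
      · split_ifs <;> omega
      · rw [if_pos rfl]; omega) (h.lower_top ht ht2) (labelBy_injective _) rfl
    rw [h.eulerianPoly_lower_top hω ht ht2] at hg
    by_cases hr : r = ρ t
    · rw [if_pos hr] at hd hg
      obtain ⟨h2, hg⟩ := hg.of_X_mul (eulerianPoly_ne_zero hω)
      exact ⟨d - 2, by omega, hg⟩
    · rw [if_neg hr] at hd hg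
      rw [one_mul] at hg
      exact ⟨d, hd, hg⟩
  by_cases hb2 : ρ b ≤ -1
  · obtain ⟨d, hd, hg⟩ := ih _ (by
      rw [← hn]
      refine Finset.sum_lt_sum (fun x _ => ?_) ⟨b, Finset.mem_univ b, ?_⟩
      · split_ifs <;> omega
      · rw [if_pos rfl]; omega) (h.raise_bottom hb hb2) (labelBy_injective _) rfl
    rw [h.eulerianPoly_raise_bottom hω hb hb2]
    by_cases hr : r = ρ b
    · rw [if_pos hr] at hd ⊢
      exact ⟨d + 2, by push_cast; omega, hg.X_mul⟩
    · rw [if_neg hr] at hd ⊢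
      rw [one_mul]
      exact ⟨d, hd, hg⟩
  · refine h.hasGammaExpansion_of_mem_zero_one hω fun x => ?_
    have := ht x; have := hb x
    omega

end Relabel

end SignGraded

theorem mainTheorem8 {P : Type*} [PartialOrder P] [Fintype P] [Nonempty P]
    (ω : P → ℤ) (hω : Function.Injective ω) (r : ℤ) (hr : SignGraded.IsSignGraded ω r) :
    ∃ d : ℕ, (d : ℤ) = (Fintype.card P : ℤ) - r - 1 ∧
      -- the Eulerian polynomial has a nonnegative expansion
      (∃ a : ℕ → ℕ, SignGraded.eulerianPoly ω =
        ∑ i ∈ Finset.range (d / 2 + 1), Polynomial.C (a i : ℤ) *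
          (Polynomial.X ^ i * (1 + Polynomial.X) ^ (d - 2 * i))) ∧
      (SignGraded.IsCanonical ω →
        -- the maps `ψ_x` are commuting involutions of the Jordan–Hölder set
        (∀ x : P, ∀ π ∈ SignGraded.jordanHolder ω,
          SignGraded.psi (ω x) π ∈ SignGraded.jordanHolder ω ∧
          SignGraded.psi (ω x) (SignGraded.psi (ω x) π) = π) ∧
        (∀ x y : P, ∀ π ∈ SignGraded.jordanHolder ω,
          SignGraded.psi (ω x) (SignGraded.psi (ω y) π) =
            SignGraded.psi (ω y) (SignGraded.psi (ω x) π)) ∧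
        -- every orbit has exactly one element without double descents, which determines
        -- the descent generating function and, in rank zero, the number of peaks
        (∀ π ∈ SignGraded.jordanHolder ω, ∃ πhat : List ℤ,
          (πhat ∈ SignGraded.orb ω π ∧ SignGraded.NoDoubleDescent πhat) ∧
          (∀ σ ∈ SignGraded.orb ω π, SignGraded.NoDoubleDescent σ → σ = πhat) ∧
          2 * SignGraded.des πhat ≤ d ∧
          (∑ σ ∈ SignGraded.orb ω π, (Polynomial.X : Polynomial ℤ) ^ SignGraded.des σ) =
            Polynomial.X ^ SignGraded.des πhat *
              (1 + Polynomial.X) ^ (d - 2 * SignGraded.des πhat) ∧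
          (r = 0 →
            (∀ S : Finset P,
              SignGraded.peak (SignGraded.psiSet ω S π) = SignGraded.peak π) ∧
            SignGraded.peak π = SignGraded.des πhat)) ∧
        -- the coefficients count the linear extensions without double descents
        SignGraded.eulerianPoly ω =
          ∑ i ∈ Finset.range (d / 2 + 1),
            Polynomial.C (((SignGraded.jordanHolder ω).filter
              (fun π => SignGraded.NoDoubleDescent π ∧ SignGraded.des π = i)).card : ℤ) *
              (Polynomial.X ^ i * (1 + Polynomial.X) ^ (d - 2 * i))) := by
  obtain ⟨ρ, hρ, -⟩ := hr.exists_isRankFunction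
  obtain ⟨d, hd, hg⟩ := hρ.hasGammaExpansion hω
  refine ⟨d, hd, hg, fun hc => ?_⟩
  have h := hr.isAlternating hc
  refine ⟨fun x π hπ => ⟨h.psi_mem hω x hπ, h.psi_psi hω x hπ⟩,
    fun x y π hπ => h.psi_comm hω x y hπ, fun π hπ => ?_, h.eulerianPoly_eq hω hd⟩
  classical
  have hτ : SignGraded.hat ω π ∈ SignGraded.jordanHolder ω := SignGraded.psiSet_mem hω h _ hπ
  have h1 := SignGraded.noDoubleDescent_hat hω h hπ
  have horb : SignGraded.orb ω (SignGraded.hat ω π) = SignGraded.orb ω π :=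
    SignGraded.orb_psiSet hω h _ hπ
  refine ⟨SignGraded.hat ω π, ⟨SignGraded.mem_orb.2 ⟨_, rfl⟩, h1⟩, fun σ hσ h2 => ?_, ?_, ?_,
    fun hr0 => ⟨fun S => ?_, ?_⟩⟩
  · rw [← horb] at hσ
    obtain ⟨S, rfl⟩ := SignGraded.mem_orb.1 hσ
    exact SignGraded.psiSet_eq_of_noDoubleDescent hω h hτ h1 h2
  · have := h.two_mul_des_le hω hd hτ h1
    omega
  · rw [← horb]
    exact h.sum_orb hω hd hτ h1
  · rw [SignGraded.peak_eq_card hω (SignGraded.psiSet_mem hω h S hπ),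
      SignGraded.peak_eq_card hω hπ, (h.psiSet_sets hω S hπ).2.1]
  -- For `r = 0` and no double descents, the first letter count says that descents and peaks are
  -- equinumerous in `hat ω π`, whose peak set is that of `π`.
  · have h3 := (h.des_counts hω hτ).1
    rw [(SignGraded.noDoubleDescent_iff hω hτ).1 h1, hr0, SignGraded.hat,
      (h.psiSet_sets hω _ hπ).2.1, ← SignGraded.peak_eq_card hω hπ, Finset.card_empty] at h3
    rw [SignGraded.hat]
    omega
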